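/- Let $\mathcal X,\mathcal Y,\hat{\mathcal X}_1,\hat{\mathcal X}_2$ be finite alphabets, let $(X_i,Y_i)$, $i\ge 1$, be i.i.d. with probability mass function $P(x,y)$ on $\mathcal X\times\mathcal Y$, and let $d_i:\mathcal X\times\hat{\mathcal X}_i\to[0,\infty)$, $i=1,2$, be distortion measures, and $D_1,D_2\in\mathbb R$. Logarithms are to base $2$. An $(n,M_1,M_2,M_3,D_1,D_2)$ triangular code consists of encoders $f_1:\mathcal X^n\times\mathcal Y^n\to\{1,\dots,M_1\}$ (encoder to User 1), $f_2:\mathcal Y^n\times\{1,\dots,M_1\}\to\{1,\dots,M_2\}$ (User 1 to User 2), $f_3:\mathcal X^n\times\mathcal Y^n\to\{1,\dots,M_3\}$ (encoder to User 2) and decoders $g_1:\mathcal Y^n\times\{1,\dots,M_1\}\to\hat{\mathcal X}_1^n$, $g_2:\{1,\dots,M_2\}\times\{1,\dots,M_3\}\to\hat{\mathcal X}_2^n$ such that, with $T_1=f_1(X^n,Y^n)$, $T_2=f_2(Y^n,T_1)$, $T_3=f_3(X^n,Y^n)$, $\hat X_1^n=g_1(Y^n,T_1)$ and $\hat X_2^n=g_2(T_2,T_3)$,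 one has $\mathbb E\big[\frac1n\sum_{i=1}^n d_j(X_i,\hat X_{j,i})\big]\le D_j$ for $j=1,2$. A triple $(R_1,R_2,R_3)\in\mathbb R^3$ is achievable if for every $\epsilon>0$ and all sufficiently large $n$ there is an $(n,\lfloor 2^{nR_1}\rfloor,\lfloor 2^{nR_2}\rfloor,\lfloor 2^{nR_3}\rfloor,D_1+\epsilon,D_2+\epsilon)$ triangular code. The achievable region $\mathcal R^O_\Delta(D_1,D_2)$ is the closure in $\mathbb R^3$ of the set of achievable triples. Theorem. $\mathcal R^O_\Delta(D_1,D_2)=\mathcal R_\Delta(D_1,D_2)$, where $\mathcal R_\Delta(D_1,D_2)$ is the set of all $(R_1,R_2,R_3)\in\mathbb R^3$ such that $$R_1\ge I(X;\hat X_1,U|Y),\qquad R_2\ge I(X,Y;U),\qquad R_3\ge I(X;\hat X_2|U)$$ for some random variable $U$ with a finite alphabet and some joint distribution of the form $P(x,y)P(\hat x_1,\hat x_2,u|x,y)$ satisfying $\mathbb E\,d_i(X,\hat X_i)\le D_i$, $i=1,2$. Moreover, $\mathcal R_\Delta(D_1,D_2)$ is unchanged if the alphabet of $U$ is required to have cardinality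 at most $|\mathcal X||\mathcal Y||\hat{\mathcal X}_1||\hat{\mathcal X}_2|+2$. -/

import Mathlib

namespace TriangularSC

/-! Information measures of random variables on a finite sample space `Ω`, whose probability mass
function is `p : Ω → ℝ`. All logarithms are to base 2. -/

section Information

variable {Ω α β γ : Type*} [Fintype Ω] [Fintype α] [Fintype β] [Fintype γ]

open Classical in
/-- The probability mass function of the random variable `A` under `p`. -/
noncomputable def law (p : Ω → ℝ) (A : Ω → α) (a : α) : ℝ :=
  ∑ ω, if A ω = a then p ω else 0

/-- The mutual information
`I(A;B) = ∑ p(a,b) log₂ (p(a,b) / (p(a) p(b)))`. A term with `p(a,b) = 0` contributes `0`. -/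
noncomputable def mutualInfo (p : Ω → ℝ) (A : Ω → α) (B : Ω → β) : ℝ :=
  ∑ a, ∑ b, law p (fun ω => (A ω, B ω)) (a, b) *
    Real.logb 2 (law p (fun ω => (A ω, B ω)) (a, b) / (law p A a * law p B b))

/-- The conditional mutual information
`I(A;B|C) = ∑ p(a,b,c) log₂ (p(a,b|c) / (p(a|c) p(b|c)))`, the ratio being written as
`p(a,b,c) p(c) / (p(a,c) p(b,c))`. A term with `p(a,b,c) = 0` contributes `0`. -/
noncomputable def condMutualInfo (p : Ω → ℝ) (A : Ω → α) (B : Ω → β) (C : Ω → γ) : ℝ :=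
  ∑ a, ∑ b, ∑ c, law p (fun ω => (A ω, B ω, C ω)) (a, b, c) *
    Real.logb 2 (law p (fun ω => (A ω, B ω, C ω)) (a, b, c) * law p C c /
      (law p (fun ω => (A ω, C ω)) (a, c) * law p (fun ω => (B ω, C ω)) (b, c)))

end Information

/-! The coding problem. The source alphabet is `𝒳`, the side information alphabet is `𝒴`, the
reconstruction alphabets of User 1 and User 2 are `𝒳₁` and `𝒳₂`. -/

/-- A triangular code of block length `n` with message sets of sizes `M₁`, `M₂`, `M₃`.
The encoder sees the source and the side information, sends a message to User 1 (by `f₁`) and a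
message to User 2 (by `f₃`). User 1 sees the side information and the first message, sends a message
to User 2 (by `f₂`) and reconstructs (by `g₁`). User 2 sees the two messages sent to it and
reconstructs (by `g₂`). -/
structure Code (𝒳 𝒴 𝒳₁ 𝒳₂ : Type*) (n M₁ M₂ M₃ : ℕ) where
  f₁ : (Fin n → 𝒳) × (Fin n → 𝒴) → Fin M₁
  f₂ : (Fin n → 𝒴) × Fin M₁ → Fin M₂
  f₃ : (Fin n → 𝒳) × (Fin n → 𝒴) → Fin M₃
  g₁ : (Fin n → 𝒴) × Fin M₁ → (Fin n → 𝒳₁)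
  g₂ : Fin M₂ × Fin M₃ → (Fin n → 𝒳₂)

section Operational

variable {𝒳 𝒴 𝒳₁ 𝒳₂ : Type*} {n M₁ M₂ M₃ : ℕ}

/-- The reconstruction of User 1 when the source is `x` and the side information is `y`. -/
def Code.recon₁ (c : Code 𝒳 𝒴 𝒳₁ 𝒳₂ n M₁ M₂ M₃) (x : Fin n → 𝒳) (y : Fin n → 𝒴) :
    Fin n → 𝒳₁ :=
  c.g₁ (y, c.f₁ (x, y))

/-- The reconstruction of User 2 when the source is `x` and the side information is `y`. -/
def Code.recon₂ (c : Code 𝒳 𝒴 𝒳₁ 𝒳₂ n M₁ M₂ M₃) (x : Fin n → 𝒳) (y : Fin n → 𝒴) :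
    Fin n → 𝒳₂ :=
  c.g₂ (c.f₂ (y, c.f₁ (x, y)), c.f₃ (x, y))

variable [Fintype 𝒳] [Fintype 𝒴]

/-- The expected average per-letter distortion `E[(1/n) ∑ j, d (X j) (X̂ j)]`, where the pairs
`(X j, Y j)` are i.i.d. with probability mass function `P`, and `X̂ = r X Y`. -/
noncomputable def expectedDistortion {𝒵 : Type*} (P : 𝒳 × 𝒴 → ℝ) (d : 𝒳 → 𝒵 → ℝ)
    (r : (Fin n → 𝒳) → (Fin n → 𝒴) → (Fin n → 𝒵)) : ℝ :=
  ∑ x : Fin n → 𝒳, ∑ y : Fin n → 𝒴,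
    (∏ j, P (x j, y j)) * ((1 / (n : ℝ)) * ∑ j, d (x j) (r x y j))

/-- The rate triple `(R₁, R₂, R₃)` is achievable: for every `ε > 0` and all sufficiently large `n`
there is a code of block length `n`, with message sets of sizes `2 ^ (n Rᵢ)` (rounded down to an
integer), whose expected distortions are at most `D₁ + ε` and `D₂ + ε`. -/
def Achievable (P : 𝒳 × 𝒴 → ℝ) (d₁ : 𝒳 → 𝒳₁ → ℝ) (d₂ : 𝒳 → 𝒳₂ → ℝ) (D₁ D₂ : ℝ)
    (R : ℝ × ℝ × ℝ) : Prop :=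
  ∀ ε : ℝ, 0 < ε → ∃ n₀ : ℕ, ∀ n : ℕ, n₀ ≤ n →
    ∃ c : Code 𝒳 𝒴 𝒳₁ 𝒳₂ n ⌊(2 : ℝ) ^ ((n : ℝ) * R.1)⌋₊
        ⌊(2 : ℝ) ^ ((n : ℝ) * R.2.1)⌋₊ ⌊(2 : ℝ) ^ ((n : ℝ) * R.2.2)⌋₊,
      expectedDistortion P d₁ c.recon₁ ≤ D₁ + ε ∧ expectedDistortion P d₂ c.recon₂ ≤ D₂ + ε

/-- The operational achievable region: the closure of the set of achievable rate triples. -/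
def achievableRegion (P : 𝒳 × 𝒴 → ℝ) (d₁ : 𝒳 → 𝒳₁ → ℝ) (d₂ : 𝒳 → 𝒳₂ → ℝ) (D₁ D₂ : ℝ) :
    Set (ℝ × ℝ × ℝ) :=
  closure {R | Achievable P d₁ d₂ D₁ D₂ R}

end Operational

section SingleLetter

variable {𝒳 𝒴 𝒳₁ 𝒳₂ : Type*} [Fintype 𝒳] [Fintype 𝒴] [Fintype 𝒳₁] [Fintype 𝒳₂]

/-- The joint probability mass function `P(x,y) W(x̂₁,x̂₂,u|x,y)`. -/
def joint {𝒰 : Type*} (P : 𝒳 × 𝒴 → ℝ) (W : 𝒳 × 𝒴 → 𝒳₁ × 𝒳₂ × 𝒰 → ℝ) :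
    𝒳 × 𝒴 × 𝒳₁ × 𝒳₂ × 𝒰 → ℝ :=
  fun (x, y, a, b, u) => P (x, y) * W (x, y) (a, b, u)

/-- The rate triples that satisfy the single-letter inequalities under the joint probability mass
function `q` of `(X, Y, X̂₁, X̂₂, U)`. -/
def RateConstraints {𝒰 : Type*} [Fintype 𝒰] (q : 𝒳 × 𝒴 × 𝒳₁ × 𝒳₂ × 𝒰 → ℝ)
    (R : ℝ × ℝ × ℝ) : Prop :=
  let X : 𝒳 × 𝒴 × 𝒳₁ × 𝒳₂ × 𝒰 → 𝒳 := fun ω => ω.1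
  let Y : 𝒳 × 𝒴 × 𝒳₁ × 𝒳₂ × 𝒰 → 𝒴 := fun ω => ω.2.1
  let X₁ : 𝒳 × 𝒴 × 𝒳₁ × 𝒳₂ × 𝒰 → 𝒳₁ := fun ω => ω.2.2.1
  let X₂ : 𝒳 × 𝒴 × 𝒳₁ × 𝒳₂ × 𝒰 → 𝒳₂ := fun ω => ω.2.2.2.1
  let U : 𝒳 × 𝒴 × 𝒳₁ × 𝒳₂ × 𝒰 → 𝒰 := fun ω => ω.2.2.2.2
  condMutualInfo q X (fun ω => (X₁ ω, U ω)) Y ≤ R.1 ∧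
  mutualInfo q (fun ω => (X ω, Y ω)) U ≤ R.2.1 ∧
  condMutualInfo q X X₂ U ≤ R.2.2

/-- The distortion constraints `E d₁(X, X̂₁) ≤ D₁` and `E d₂(X, X̂₂) ≤ D₂` under `q`. -/
def DistortionConstraints {𝒰 : Type*} [Fintype 𝒰] (q : 𝒳 × 𝒴 × 𝒳₁ × 𝒳₂ × 𝒰 → ℝ)
    (d₁ : 𝒳 → 𝒳₁ → ℝ) (d₂ : 𝒳 → 𝒳₂ → ℝ) (D₁ D₂ : ℝ) : Prop :=
  ∑ ω, q ω * d₁ ω.1 ω.2.2.1 ≤ D₁ ∧ ∑ ω, q ω * d₂ ω.1 ω.2.2.2.1 ≤ D₂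

/-- The rate triples that are obtained with an auxiliary variable `U` with values in the alphabet
`𝒰`, over all conditional distributions `W` of `(X̂₁, X̂₂, U)` given `(X, Y)`. -/
def regionWith (𝒰 : Type*) [Fintype 𝒰] (P : 𝒳 × 𝒴 → ℝ) (d₁ : 𝒳 → 𝒳₁ → ℝ)
    (d₂ : 𝒳 → 𝒳₂ → ℝ) (D₁ D₂ : ℝ) : Set (ℝ × ℝ × ℝ) :=
  {R | ∃ W : 𝒳 × 𝒴 → 𝒳₁ × 𝒳₂ × 𝒰 → ℝ,
    (∀ s, W s ∈ stdSimplex ℝ (𝒳₁ × 𝒳₂ × 𝒰)) ∧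
    DistortionConstraints (joint P W) d₁ d₂ D₁ D₂ ∧ RateConstraints (joint P W) R}

/-- The single-letter region, with auxiliary variables over arbitrary finite alphabets. -/
def region (P : 𝒳 × 𝒴 → ℝ) (d₁ : 𝒳 → 𝒳₁ → ℝ) (d₂ : 𝒳 → 𝒳₂ → ℝ) (D₁ D₂ : ℝ) :
    Set (ℝ × ℝ × ℝ) :=
  ⋃ k : ℕ, regionWith (Fin k) P d₁ d₂ D₁ D₂

/-- The single-letter region, with auxiliary variables over alphabets of at most `K` letters. -/
def boundedRegion (K : ℕ) (P : 𝒳 × 𝒴 → ℝ) (d₁ : 𝒳 → 𝒳₁ → ℝ) (d₂ : 𝒳 → 𝒳₂ → ℝ)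
    (D₁ D₂ : ℝ) : Set (ℝ × ℝ × ℝ) :=
  ⋃ k : ℕ, ⋃ _ : k ≤ K, regionWith (Fin k) P d₁ d₂ D₁ D₂

end SingleLetter

end TriangularSC

/-! The operational region is contained in the single-letter region by an entropy argument, and conversely
by an explicit coding scheme. The bound on the alphabet of `U` comes from a linear program, and it is what
makes the single-letter region closed.

*Converse.* For a code of block length `n`, let `T₁, T₂, T₃` be its messages, and let `U` consist of a
uniform time index `i`, of `T₂` and of all source pairs `(X_j, Y_j)` with `j < i`. Each of the three
single-letter quantities, summed over `i`, is bounded by a telescoping sum of entropies whose value is at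
most the entropy of the corresponding message (`Code.mem_regionWith`). Hence every achievable triple lies
in the single-letter region with distortion levels `D₁ + ε`, `D₂ + ε`, for each `ε > 0`.

*Cardinality and closedness.* For fixed conditional laws given `U = u`, the law of `(X, Y, X̂₁, X̂₂)` and
the three rates are affine in the law of `U`. With the former and two of the rates held fixed, a linear
program that minimizes the third rate has a solution of support at most `|𝒳||𝒴||𝒳₁||𝒳₂| + 2`
(`regionWith_subset_boundedRegion`). For an alphabet of bounded size, the conditional laws form a compact
set on which the rates are continuous, so that the region depends on the distortion levels in a closed
way (`isClosed_setOf_mem_boundedRegion`). This absorbs both the `ε` of the converse and the closure in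
the definition of the operational region.

*Achievability.* Codebooks are built by a greedy form of the covering lemma (`exists_codebook`), which
replaces random coding: a codeword that covers at least the average part of what is still uncovered exists
at each step. A codebook of about `2 ^ (n I(X,Y;U))` words `u` covers the source pairs `(x, y)`. Since
the encoder knows `y`, no binning is needed: it describes `u` to User 1 by its index in the list of the
codewords that are jointly typical with `y`, which has about `2 ^ (n I(X;U|Y))` members, and adds the
index of `x̂₁` in a codebook for the pair `(u, y)`, at rate `I(X;X̂₁|Y,U)`. User 1 forwards the index of
`u`, and User 2 gets `x̂₂` from a codebook for `u`, at rate `I(X;X̂₂|U)` (`exists_one_shot_code`). The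
probability of failure vanishes by the weak law of large numbers for the log densities and the
distortions (`tendsto_prob_atypical`). -/

namespace TriangularSC

/-! ### Entropy of random variables on a finite probability space -/

section Entropy

variable {Ω Ω' α β γ α' β' ι : Type*} [Fintype Ω] [Fintype Ω'] {p : Ω → ℝ}

/-- The Shannon entropy (base 2) of the random variable `A`, written as an expectation over the
sample space. In this form it depends on `A` only through the partition of `Ω` into the fibres of
`A`, and no finiteness of the range of `A` is needed. -/
noncomputable def ent (p : Ω → ℝ) (A : Ω → α) : ℝ :=
  -∑ ω, p ω * Real.logb 2 (law p A (A ω))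

lemma law_nonneg (hp : ∀ ω, 0 ≤ p ω) (A : Ω → α) (a : α) : 0 ≤ law p A a :=
  Finset.sum_nonneg fun ω _ => by split_ifs <;> simp [hp]

lemma law_mono (hp : ∀ ω, 0 ≤ p ω) {A : Ω → α} {B : Ω → β} {a : α} {b : β}
    (h : ∀ ω, A ω = a → B ω = b) : law p A a ≤ law p B b := by
  refine Finset.sum_le_sum fun ω _ => ?_
  by_cases h1 : A ω = a
  · simp [h1, h ω h1]
  · rw [if_neg h1]; split_ifs <;> simp [hp]

lemma law_congr {A : Ω → α} {B : Ω → β} {a : α} {b : β}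
    (h : ∀ ω, A ω = a ↔ B ω = b) : law p A a = law p B b := by
  refine Finset.sum_congr rfl fun ω _ => ?_
  by_cases hA : A ω = a
  · rw [if_pos hA, if_pos ((h ω).1 hA)]
  · rw [if_neg hA, if_neg (mt (h ω).2 hA)]

lemma le_law (hp : ∀ ω, 0 ≤ p ω) (A : Ω → α) (ω : Ω) : p ω ≤ law p A (A ω) := by
  classical
  have := Finset.single_le_sum (f := fun ω' => if A ω' = A ω then p ω' else 0)
    (fun ω' _ => by split_ifs <;> simp [hp]) (Finset.mem_univ ω)
  simpa [law] using this

lemma law_pos (hp : ∀ ω, 0 ≤ p ω) (A : Ω → α) {ω : Ω} (h : 0 < p ω) : 0 < law p A (A ω) :=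
  h.trans_le (le_law hp A ω)

lemma sum_law_mul [Fintype α] (p : Ω → ℝ) (A : Ω → α) (φ : α → ℝ) :
    ∑ a, law p A a * φ a = ∑ ω, p ω * φ (A ω) := by
  classical
  simp only [law, Finset.sum_mul]
  rw [Finset.sum_comm]
  refine Finset.sum_congr rfl fun ω _ => ?_
  rw [Finset.sum_eq_single (A ω)] <;> simp +contextual [eq_comm]

lemma sum_law [Fintype α] (p : Ω → ℝ) (A : Ω → α) : ∑ a, law p A a = ∑ ω, p ω := by
  simpa using sum_law_mul p A (fun _ => 1)

lemma sum_law_prod [Fintype β] (p : Ω → ℝ) (A : Ω → α) (B : Ω → β) (a : α) :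
    ∑ b, law p (fun ω => (A ω, B ω)) (a, b) = law p A a := by
  classical
  simp only [law]
  rw [Finset.sum_comm]
  refine Finset.sum_congr rfl fun ω _ => ?_
  by_cases h : A ω = a <;> simp [h]

lemma sum_law_prod' [Fintype α] (p : Ω → ℝ) (A : Ω → α) (B : Ω → β) (b : β) :
    ∑ a, law p (fun ω => (A ω, B ω)) (a, b) = law p B b := by
  rw [← sum_law_prod p B A b]
  exact Finset.sum_congr rfl fun a _ => law_congr fun ω => by simp [and_comm]

lemma law_law [Fintype α] (p : Ω → ℝ) (F : Ω → α) (A : α → β) (b : β) :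
    law (law p F) A b = law p (fun ω => A (F ω)) b := by
  classical
  have := sum_law_mul p F (fun a => if A a = b then 1 else 0)
  simpa [law] using this

lemma law_mem_stdSimplex [Fintype α] (hp : p ∈ stdSimplex ℝ Ω) (A : Ω → α) :
    law p A ∈ stdSimplex ℝ α :=
  ⟨law_nonneg hp.1 A, by rw [sum_law, hp.2]⟩

lemma ent_law [Fintype α] (p : Ω → ℝ) (F : Ω → α) (A : α → β) :
    ent (law p F) A = ent p (fun ω => A (F ω)) := by
  simp only [ent, law_law]
  rw [sum_law_mul p F (fun a => Real.logb 2 (law p (fun ω => A (F ω)) (A a)))]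

lemma ent_congr_law [Fintype α] {p' : Ω' → ℝ} {A : Ω → α} {A' : Ω' → α}
    (h : law p A = law p' A') (f : α → β) :
    ent p (fun ω => f (A ω)) = ent p' (fun ω => f (A' ω)) := by
  rw [← ent_law p A f, h, ent_law]

lemma ent_congr {A : Ω → α} {B : Ω → β} (h : ∀ ω ω', A ω = A ω' ↔ B ω = B ω') :
    ent p A = ent p B := by
  simp only [ent]
  congr 1
  exact Finset.sum_congr rfl fun ω _ => by rw [law_congr (B := B) (b := B ω) fun ω' => h ω' ω]

lemma law_id (p : Ω → ℝ) : law p (fun ω => ω) = p := by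
  classical
  funext a
  rw [law, Finset.sum_eq_single a]
  · rw [if_pos rfl]
  · exact fun b _ hb => if_neg hb
  · simp

lemma law_comp_equiv (e : Ω' ≃ Ω) (p : Ω → ℝ) (A : Ω → α) (a : α) :
    law (fun ω => p (e ω)) (fun ω => A (e ω)) a = law p A a := by
  classical
  exact e.sum_comp (fun ω => if A ω = a then p ω else 0)

lemma ent_comp_equiv (e : Ω' ≃ Ω) (p : Ω → ℝ) (A : Ω → α) :
    ent (fun ω => p (e ω)) (fun ω => A (e ω)) = ent p A := by
  simp only [ent, law_comp_equiv e p A]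
  rw [e.sum_comp (fun ω => p ω * Real.logb 2 (law p A (A ω)))]

lemma ent_const (hp : p ∈ stdSimplex ℝ Ω) (a : α) : ent p (fun _ => a) = 0 := by
  simp [ent, law, hp.2]

lemma mutualInfo_eq [Fintype α] [Fintype β] (hp : ∀ ω, 0 ≤ p ω) (A : Ω → α) (B : Ω → β) :
    mutualInfo p A B = ent p A + ent p B - ent p (fun ω => (A ω, B ω)) := by
  have key := sum_law_mul p (fun ω => (A ω, B ω)) (fun ab =>
    Real.logb 2 (law p (fun ω => (A ω, B ω)) ab / (law p A ab.1 * law p B ab.2)))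
  rw [Fintype.sum_prod_type] at key
  simp only [mutualInfo, key, ent]
  rw [← Finset.sum_neg_distrib, ← Finset.sum_neg_distrib, ← Finset.sum_neg_distrib,
    ← Finset.sum_add_distrib, ← Finset.sum_sub_distrib]
  refine Finset.sum_congr rfl fun ω _ => ?_
  rcases (hp ω).eq_or_lt with h0 | h0
  · simp [← h0]
  · have h1 := (law_pos hp A h0).ne'
    have h2 := (law_pos hp B h0).ne'
    have h3 := (law_pos hp (fun ω => (A ω, B ω)) h0).ne'
    rw [Real.logb_div h3 (mul_ne_zero h1 h2), Real.logb_mul h1 h2]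
    ring

lemma condMutualInfo_eq [Fintype α] [Fintype β] [Fintype γ] (hp : ∀ ω, 0 ≤ p ω) (A : Ω → α)
    (B : Ω → β) (C : Ω → γ) :
    condMutualInfo p A B C = ent p (fun ω => (A ω, C ω)) + ent p (fun ω => (B ω, C ω)) -
      ent p (fun ω => (A ω, B ω, C ω)) - ent p C := by
  have key := sum_law_mul p (fun ω => (A ω, B ω, C ω)) (fun t =>
    Real.logb 2 (law p (fun ω => (A ω, B ω, C ω)) t * law p C t.2.2 /
      (law p (fun ω => (A ω, C ω)) (t.1, t.2.2) * law p (fun ω => (B ω, C ω)) (t.2.1, t.2.2))))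
  simp only [Fintype.sum_prod_type] at key
  simp only [condMutualInfo, key, ent]
  simp only [← Finset.sum_neg_distrib, ← Finset.sum_add_distrib, ← Finset.sum_sub_distrib]
  refine Finset.sum_congr rfl fun ω _ => ?_
  rcases (hp ω).eq_or_lt with h0 | h0
  · simp [← h0]
  · have h1 := (law_pos hp (fun ω => (A ω, C ω)) h0).ne'
    have h2 := (law_pos hp (fun ω => (B ω, C ω)) h0).ne'
    have h3 := (law_pos hp (fun ω => (A ω, B ω, C ω)) h0).ne'
    have h4 := (law_pos hp C h0).ne'
    rw [Real.logb_div (mul_ne_zero h3 h4) (mul_ne_zero h1 h2), Real.logb_mul h1 h2,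
      Real.logb_mul h3 h4]
    ring

/-- Gibbs' inequality, in the form in which it is used for submodularity and for the bound of
entropy by the logarithm of the size of the alphabet. -/
lemma sum_mul_logb_le (hp : p ∈ stdSimplex ℝ Ω) {r : Ω → ℝ} (hr : ∀ ω, 0 < p ω → 0 < r ω)
    (h : ∑ ω, p ω * r ω ≤ 1) : ∑ ω, p ω * Real.logb 2 (r ω) ≤ 0 := by
  have hl : 0 < Real.log 2 := Real.log_pos one_lt_two
  have : ∑ ω, p ω * Real.logb 2 (r ω) ≤ ∑ ω, (p ω * r ω - p ω) / Real.log 2 := by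
    refine Finset.sum_le_sum fun ω _ => ?_
    rcases (hp.1 ω).eq_or_lt with h0 | h0
    · simp [← h0]
    · rw [Real.logb, ← mul_div_assoc]
      refine div_le_div_of_nonneg_right ?_ hl.le
      nlinarith [Real.log_le_sub_one_of_pos (hr ω h0)]
  refine this.trans ?_
  rw [← Finset.sum_div, Finset.sum_sub_distrib, hp.2]
  exact div_nonpos_of_nonpos_of_nonneg (by linarith) hl.le

/-- Submodularity of entropy, that is `0 ≤ I(A;B|C)`. -/
lemma ent_submodular [Fintype α] [Fintype β] [Fintype γ] (hp : p ∈ stdSimplex ℝ Ω) (A : Ω → α)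
    (B : Ω → β) (C : Ω → γ) :
    ent p (fun ω => (A ω, B ω, C ω)) + ent p C ≤
      ent p (fun ω => (A ω, C ω)) + ent p (fun ω => (B ω, C ω)) := by
  have key := sum_mul_logb_le hp (r := fun ω => law p (fun ω => (A ω, C ω)) (A ω, C ω) *
    law p (fun ω => (B ω, C ω)) (B ω, C ω) / (law p (fun ω => (A ω, B ω, C ω)) (A ω, B ω, C ω) *
      law p C (C ω))) (fun ω h0 => div_pos (mul_pos (law_pos hp.1 (fun ω => (A ω, C ω)) h0)
        (law_pos hp.1 (fun ω => (B ω, C ω)) h0)) (mul_pos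
          (law_pos hp.1 (fun ω => (A ω, B ω, C ω)) h0) (law_pos hp.1 C h0))) ?_
  · have e : ∑ ω, p ω * Real.logb 2 (law p (fun ω => (A ω, C ω)) (A ω, C ω) *
        law p (fun ω => (B ω, C ω)) (B ω, C ω) /
        (law p (fun ω => (A ω, B ω, C ω)) (A ω, B ω, C ω) * law p C (C ω))) =
        ent p (fun ω => (A ω, B ω, C ω)) + ent p C - ent p (fun ω => (A ω, C ω)) -
          ent p (fun ω => (B ω, C ω)) := by
      simp only [ent]
      simp only [← Finset.sum_neg_distrib, ← Finset.sum_add_distrib, ← Finset.sum_sub_distrib]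
      refine Finset.sum_congr rfl fun ω _ => ?_
      rcases (hp.1 ω).eq_or_lt with h0 | h0
      · simp [← h0]
      · have h1 := (law_pos hp.1 (fun ω => (A ω, C ω)) h0).ne'
        have h2 := (law_pos hp.1 (fun ω => (B ω, C ω)) h0).ne'
        have h3 := (law_pos hp.1 (fun ω => (A ω, B ω, C ω)) h0).ne'
        have h4 := (law_pos hp.1 C h0).ne'
        rw [Real.logb_div (mul_ne_zero h1 h2) (mul_ne_zero h3 h4), Real.logb_mul h1 h2,
          Real.logb_mul h3 h4]
        ring
    linarith
  · have e := sum_law_mul p (fun ω => (A ω, B ω, C ω)) (fun t =>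
      law p (fun ω => (A ω, C ω)) (t.1, t.2.2) * law p (fun ω => (B ω, C ω)) (t.2.1, t.2.2) /
        (law p (fun ω => (A ω, B ω, C ω)) t * law p C t.2.2))
    rw [← e]
    have hle : ∀ t : α × β × γ, law p (fun ω => (A ω, B ω, C ω)) t *
        (law p (fun ω => (A ω, C ω)) (t.1, t.2.2) * law p (fun ω => (B ω, C ω)) (t.2.1, t.2.2) /
        (law p (fun ω => (A ω, B ω, C ω)) t * law p C t.2.2)) ≤
        law p (fun ω => (A ω, C ω)) (t.1, t.2.2) * law p (fun ω => (B ω, C ω)) (t.2.1, t.2.2) /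
          law p C t.2.2 := by
      intro t
      have n1 := law_nonneg hp.1 (fun ω => (A ω, C ω)) (t.1, t.2.2)
      have n2 := law_nonneg hp.1 (fun ω => (B ω, C ω)) (t.2.1, t.2.2)
      have n4 := law_nonneg hp.1 C t.2.2
      rcases (law_nonneg hp.1 (fun ω => (A ω, B ω, C ω)) t).eq_or_lt with h0 | h0
      · rw [← h0, zero_mul]; positivity
      · rw [← mul_div_assoc, mul_div_mul_left _ _ h0.ne']
    refine (Finset.sum_le_sum fun t _ => hle t).trans ?_
    have : ∑ t : α × β × γ, law p (fun ω => (A ω, C ω)) (t.1, t.2.2) *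
        law p (fun ω => (B ω, C ω)) (t.2.1, t.2.2) / law p C t.2.2 = ∑ c, law p C c := by
      rw [Fintype.sum_prod_type]
      simp only [Fintype.sum_prod_type]
      simp only [← Finset.sum_comm (s := (Finset.univ : Finset γ))]
      refine Finset.sum_congr rfl fun c _ => ?_
      simp only [mul_div_assoc, ← Finset.mul_sum, ← Finset.sum_div, sum_law_prod', ← Finset.sum_mul]
      by_cases h : law p C c = 0 <;> simp [h]
    rw [this, sum_law, hp.2]

/-- Data processing: `I(A';B'|C) ≤ I(A;B|C)` if `A'` is determined by `(A,C)` and `B'` by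
`(B,C)`. -/
lemma ent_data_processing [Fintype α] [Fintype β] [Fintype γ] [Fintype α'] [Fintype β']
    (hp : p ∈ stdSimplex ℝ Ω)
    {A : Ω → α} {B : Ω → β} {C : Ω → γ} {A' : Ω → α'} {B' : Ω → β'}
    (hA : ∀ ω ω', A ω = A ω' → C ω = C ω' → A' ω = A' ω')
    (hB : ∀ ω ω', B ω = B ω' → C ω = C ω' → B' ω = B' ω') :
    ent p (fun ω => (A' ω, C ω)) + ent p (fun ω => (B' ω, C ω)) -
      ent p (fun ω => (A' ω, B' ω, C ω)) - ent p C ≤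
    ent p (fun ω => (A ω, C ω)) + ent p (fun ω => (B ω, C ω)) -
      ent p (fun ω => (A ω, B ω, C ω)) - ent p C := by
  have h1 := ent_submodular hp A B (fun ω => (B' ω, C ω))
  have h2 := ent_submodular hp A B' (fun ω => (A' ω, C ω))
  have e1 : ent p (fun ω => (A ω, B ω, B' ω, C ω)) = ent p (fun ω => (A ω, B ω, C ω)) :=
    ent_congr fun ω ω' => by grind
  have e2 : ent p (fun ω => (B ω, B' ω, C ω)) = ent p (fun ω => (B ω, C ω)) :=
    ent_congr fun ω ω' => by grind
  have e3 : ent p (fun ω => (A ω, B' ω, A' ω, C ω)) = ent p (fun ω => (A ω, B' ω, C ω)) :=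
    ent_congr fun ω ω' => by grind
  have e4 : ent p (fun ω => (A ω, A' ω, C ω)) = ent p (fun ω => (A ω, C ω)) :=
    ent_congr fun ω ω' => by grind
  have e5 : ent p (fun ω => (B' ω, A' ω, C ω)) = ent p (fun ω => (A' ω, B' ω, C ω)) :=
    ent_congr fun ω ω' => by grind
  linarith

lemma ent_prod_le [Fintype α] [Fintype β] (hp : p ∈ stdSimplex ℝ Ω) (A : Ω → α) (B : Ω → β) :
    ent p (fun ω => (A ω, B ω)) ≤ ent p A + ent p B := by
  have h := ent_submodular hp A B (fun _ => ())
  have e1 : ent p (fun ω => (A ω, B ω, ())) = ent p (fun ω => (A ω, B ω)) :=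
    ent_congr fun ω ω' => by simp
  have e2 : ent p (fun ω => (A ω, ())) = ent p A := ent_congr fun ω ω' => by simp
  have e3 : ent p (fun ω => (B ω, ())) = ent p B := ent_congr fun ω ω' => by simp
  rw [e1, e2, e3, ent_const hp] at h
  linarith

lemma ent_le_logb_card [Fintype α] (hp : p ∈ stdSimplex ℝ Ω) (A : Ω → α) :
    ent p A ≤ Real.logb 2 (Fintype.card α) := by
  have hne : Nonempty Ω := by
    by_contra h
    rw [not_nonempty_iff] at h
    simpa using hp.2
  have : Nonempty α := hne.map A
  have hc : (0 : ℝ) < Fintype.card α := by exact_mod_cast Fintype.card_pos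
  have key := sum_mul_logb_le hp (r := fun ω => ((Fintype.card α : ℝ) * law p A (A ω))⁻¹)
    (fun ω h0 => inv_pos.2 (mul_pos hc (law_pos hp.1 A h0))) ?_
  · have e : ∑ ω, p ω * Real.logb 2 ((Fintype.card α : ℝ) * law p A (A ω))⁻¹ =
        ent p A - ∑ ω, p ω * Real.logb 2 (Fintype.card α) := by
      simp only [ent]
      simp only [← Finset.sum_neg_distrib, ← Finset.sum_sub_distrib]
      refine Finset.sum_congr rfl fun ω _ => ?_
      rcases (hp.1 ω).eq_or_lt with h0 | h0
      · simp [← h0]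
      · rw [Real.logb_inv, Real.logb_mul hc.ne' (law_pos hp.1 A h0).ne']
        ring
    rw [e, ← Finset.sum_mul, hp.2] at key
    linarith
  · rw [← sum_law_mul p A (fun a => ((Fintype.card α : ℝ) * law p A a)⁻¹)]
    have : ∀ a, law p A a * ((Fintype.card α : ℝ) * law p A a)⁻¹ ≤ (Fintype.card α : ℝ)⁻¹ := by
      intro a
      rcases (law_nonneg hp.1 A a).eq_or_lt with h0 | h0
      · rw [← h0]; simp
      · rw [mul_inv]; field_simp; rfl
    refine (Finset.sum_le_sum fun a _ => this a).trans ?_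
    simp

/-- The entropy of `(i, A)` under a mixture: `i` is drawn from `w`, then the sample point from
`r i`. -/
lemma ent_mixture [Fintype ι] {w : ι → ℝ} {r : ι → Ω → ℝ} (hw : ∀ i, 0 ≤ w i)
    (hr : ∀ i, r i ∈ stdSimplex ℝ Ω) (A : ι → Ω → α) :
    ent (fun x : ι × Ω => w x.1 * r x.1 x.2) (fun x => (x.1, A x.1 x.2)) =
      -∑ i, w i * Real.logb 2 (w i) + ∑ i, w i * ent (r i) (A i) := by
  classical
  have hl : ∀ i a, law (fun x : ι × Ω => w x.1 * r x.1 x.2) (fun x => (x.1, A x.1 x.2)) (i, a) =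
      w i * law (r i) (A i) a := by
    intro i a
    simp only [law, Fintype.sum_prod_type, Finset.mul_sum]
    rw [Finset.sum_eq_single i]
    · simp
    · intro j _ hj; simp [hj]
    · simp
  simp only [ent, Fintype.sum_prod_type, hl]
  rw [← Finset.sum_neg_distrib, ← Finset.sum_neg_distrib, ← Finset.sum_add_distrib]
  refine Finset.sum_congr rfl fun i _ => ?_
  have : w i * Real.logb 2 (w i) = ∑ ω, w i * r i ω * Real.logb 2 (w i) := by
    rw [← Finset.sum_mul, ← Finset.mul_sum, (hr i).2, mul_one]
  rw [this, mul_neg, Finset.mul_sum, ← Finset.sum_neg_distrib, ← Finset.sum_neg_distrib,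
    ← Finset.sum_neg_distrib, ← Finset.sum_add_distrib]
  refine Finset.sum_congr rfl fun ω _ => ?_
  rcases (hw i).eq_or_lt with h0 | h0
  · simp [← h0]
  rcases ((hr i).1 ω).eq_or_lt with h1 | h1
  · simp [← h1]
  · rw [Real.logb_mul h0.ne' (law_pos (hr i).1 (A i) h1).ne']
    ring

end Entropy

section Product

variable {Ω α : Type*} [Fintype Ω] {p : Ω → ℝ} {n : ℕ}

/-- The probability mass function of `n` independent draws from `p`. -/
def iid (n : ℕ) (p : Ω → ℝ) (ω : Fin n → Ω) : ℝ := ∏ j, p (ω j)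

lemma iid_nonneg {Ω : Type*} {p : Ω → ℝ} (hp : ∀ ω, 0 ≤ p ω) (ω : Fin n → Ω) : 0 ≤ iid n p ω :=
  Finset.prod_nonneg fun _ _ => hp _

lemma sum_prod_apply (f : Fin n → Ω → ℝ) : ∑ ω : Fin n → Ω, ∏ j, f j (ω j) = ∏ j, ∑ a, f j a := by
  classical
  rw [Finset.prod_univ_sum, Fintype.piFinset_univ]

lemma iid_mem_stdSimplex (hp : p ∈ stdSimplex ℝ Ω) : iid n p ∈ stdSimplex ℝ (Fin n → Ω) :=
  ⟨iid_nonneg hp.1, by simp only [iid]; rw [sum_prod_apply (fun _ => p)]; simp [hp.2]⟩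

lemma law_iid (p : Ω → ℝ) (A : Ω → α) (a : Fin n → α) :
    law (iid n p) (fun ω j => A (ω j)) a = iid n (law p A) a := by
  classical
  simp only [iid, law]
  rw [← sum_prod_apply (fun j ω => if A ω = a j then p ω else 0)]
  refine Finset.sum_congr rfl fun ω _ => ?_
  by_cases h : ∀ j, A (ω j) = a j
  · rw [if_pos (funext h)]; exact Finset.prod_congr rfl fun j _ => by simp [h j]
  · rw [if_neg fun h' => h fun j => congrFun h' j]
    push Not at h
    obtain ⟨j, hj⟩ := h
    exact (Finset.prod_eq_zero (Finset.mem_univ j) (by simp [hj])).symm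

lemma sum_iid_mul_apply (hp : p ∈ stdSimplex ℝ Ω) (φ : Ω → ℝ) (i : Fin n) :
    ∑ ω : Fin n → Ω, iid n p ω * φ (ω i) = ∑ a, p a * φ a := by
  classical
  have : ∀ ω : Fin n → Ω, iid n p ω * φ (ω i) =
      ∏ j, (p (ω j) * if j = i then φ (ω j) else 1) := by
    intro ω
    rw [Finset.prod_mul_distrib, iid, Finset.prod_ite_eq' Finset.univ i (fun j => φ (ω j))]
    simp
  simp only [this]
  rw [sum_prod_apply (fun j a => p a * if j = i then φ a else 1), Finset.prod_eq_single i]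
  · simp
  · intro j _ hj; simp [hj, hp.2]
  · simp

lemma law_iid_apply (hp : p ∈ stdSimplex ℝ Ω) (A : Ω → α) (i : Fin n) (a : α) :
    law (iid n p) (fun ω => A (ω i)) a = law p A a := by
  classical
  have := sum_iid_mul_apply hp (fun ω => if A ω = a then 1 else 0) i
  simpa [law] using this

lemma iid_pos_iff {Ω : Type*} {p : Ω → ℝ} (hp : ∀ ω, 0 ≤ p ω) (ω : Fin n → Ω) : 0 < iid n p ω ↔ ∀ j, 0 < p (ω j) := by
  constructor
  · intro h j
    refine (hp _).lt_of_ne fun h0 => h.ne' ?_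
    exact Finset.prod_eq_zero (Finset.mem_univ j) h0.symm
  · exact fun h => Finset.prod_pos fun j _ => h j

lemma ent_iid (hp : p ∈ stdSimplex ℝ Ω) (A : Ω → α) :
    ent (iid n p) (fun ω j => A (ω j)) = n * ent p A := by
  simp only [ent, law_iid]
  have : ∀ ω : Fin n → Ω, iid n p ω * Real.logb 2 (iid n (law p A) fun j => A (ω j)) =
      ∑ j, iid n p ω * Real.logb 2 (law p A (A (ω j))) := by
    intro ω
    rcases (iid_nonneg hp.1 ω).eq_or_lt with h0 | h0
    · simp [← h0]
    · rw [← Finset.mul_sum]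
      have h1 := (iid_pos_iff hp.1 ω).1 h0
      congr 1
      simp only [iid, Real.logb]
      rw [Real.log_prod fun j _ => (law_pos hp.1 A (h1 j)).ne', Finset.sum_div]
  simp only [this]
  rw [Finset.sum_comm]
  simp only [sum_iid_mul_apply hp (fun ω => Real.logb 2 (law p A (A ω)))]
  simp

end Product

/-! ### The single-letter constraints in terms of entropies -/

section Disintegration

lemma nonempty_of_mem_stdSimplex {α : Type*} [Fintype α] {p : α → ℝ} (hp : p ∈ stdSimplex ℝ α) :
    Nonempty α := by
  by_contra h
  rw [not_nonempty_iff] at h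
  simpa using hp.2

/-- A nonnegative weight on a product is a marginal times a probability kernel. -/
lemma exists_disintegration {α β : Type*} [Fintype β] [Nonempty β] (q : α × β → ℝ)
    (hq : ∀ x, 0 ≤ q x) : ∃ W : α → β → ℝ, (∀ a, W a ∈ stdSimplex ℝ β) ∧
      ∀ a b, q (a, b) = (∑ b', q (a, b')) * W a b := by
  classical
  obtain ⟨b₀⟩ := ‹Nonempty β›
  have h0 : ∀ a, 0 ≤ ∑ b', q (a, b') := fun a => Finset.sum_nonneg fun _ _ => hq _
  refine ⟨fun a b => if ∑ b', q (a, b') = 0 then (Pi.single b₀ 1 : β → ℝ) b else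
    q (a, b) / ∑ b', q (a, b'), fun a => ?_, fun a b => ?_⟩
  · by_cases h : ∑ b', q (a, b') = 0
    · simp only [h, if_true]
      exact single_mem_stdSimplex ℝ b₀
    · simp only [h, if_false]
      exact ⟨fun b => div_nonneg (hq _) (h0 a), by rw [← Finset.sum_div, div_self h]⟩
  · by_cases h : ∑ b', q (a, b') = 0
    · rw [h, zero_mul]
      exact (Finset.sum_eq_zero_iff_of_nonneg fun _ _ => hq _).1 h b (Finset.mem_univ _)
    · simp only [h, if_false]
      field_simp

end Disintegration

section Rates

variable {Ω α β γ : Type*} [Fintype Ω]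

/-- The conditional mutual information `I(A;B|C)` in terms of entropies. -/
noncomputable def cmi (p : Ω → ℝ) (A : Ω → α) (B : Ω → β) (C : Ω → γ) : ℝ :=
  ent p (fun ω => (A ω, C ω)) + ent p (fun ω => (B ω, C ω)) -
    ent p (fun ω => (A ω, B ω, C ω)) - ent p C

lemma cmi_comp_equiv {Ω' : Type*} [Fintype Ω'] (e : Ω' ≃ Ω) (p : Ω → ℝ) (A : Ω → α) (B : Ω → β)
    (C : Ω → γ) : cmi (fun ω => p (e ω)) (fun ω => A (e ω)) (fun ω => B (e ω)) (fun ω => C (e ω)) =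
      cmi p A B C := by
  simp only [cmi]
  rw [ent_comp_equiv e p (fun ω => (A ω, C ω)), ent_comp_equiv e p (fun ω => (B ω, C ω)),
    ent_comp_equiv e p (fun ω => (A ω, B ω, C ω)), ent_comp_equiv e p C]

variable {𝒳 𝒴 𝒳₁ 𝒳₂ 𝒰 𝒱 ι : Type*}

section SingleLetter

variable [Fintype 𝒳] [Fintype 𝒴] [Fintype 𝒳₁] [Fintype 𝒳₂] [Fintype 𝒰]

lemma rateConstraints_iff {q : 𝒳 × 𝒴 × 𝒳₁ × 𝒳₂ × 𝒰 → ℝ} (hq : ∀ ω, 0 ≤ q ω) (R : ℝ × ℝ × ℝ) :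
    RateConstraints q R ↔
      cmi q (fun ω => ω.1) (fun ω => (ω.2.2.1, ω.2.2.2.2)) (fun ω => ω.2.1) ≤ R.1 ∧
      ent q (fun ω => (ω.1, ω.2.1)) + ent q (fun ω => ω.2.2.2.2) -
        ent q (fun ω => ((ω.1, ω.2.1), ω.2.2.2.2)) ≤ R.2.1 ∧
      cmi q (fun ω => ω.1) (fun ω => ω.2.2.2.1) (fun ω => ω.2.2.2.2) ≤ R.2.2 := by
  simp only [RateConstraints, condMutualInfo_eq hq, mutualInfo_eq hq, cmi]

lemma sum_joint {𝒳 𝒴 : Type*} (P : 𝒳 × 𝒴 → ℝ) {W : 𝒳 × 𝒴 → 𝒳₁ × 𝒳₂ × 𝒰 → ℝ}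
    (hW : ∀ s, W s ∈ stdSimplex ℝ (𝒳₁ × 𝒳₂ × 𝒰)) (x : 𝒳) (y : 𝒴) :
    ∑ t, joint P W (x, y, t) = P (x, y) := by
  simp only [joint]
  rw [← Finset.mul_sum, (hW (x, y)).2, mul_one]

lemma joint_mem_stdSimplex {P : 𝒳 × 𝒴 → ℝ} (hP : P ∈ stdSimplex ℝ (𝒳 × 𝒴))
    {W : 𝒳 × 𝒴 → 𝒳₁ × 𝒳₂ × 𝒰 → ℝ} (hW : ∀ s, W s ∈ stdSimplex ℝ (𝒳₁ × 𝒳₂ × 𝒰)) :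
    joint P W ∈ stdSimplex ℝ (𝒳 × 𝒴 × 𝒳₁ × 𝒳₂ × 𝒰) := by
  refine ⟨fun ω => mul_nonneg (hP.1 _) ((hW _).1 _), ?_⟩
  rw [← hP.2, Fintype.sum_prod_type, Fintype.sum_prod_type]
  refine Finset.sum_congr rfl fun x _ => ?_
  rw [Fintype.sum_prod_type]
  exact Finset.sum_congr rfl fun y _ => sum_joint P hW x y

/-- The law of `(X, Y)` under `joint P W` is `P`. -/
lemma law_joint (P : 𝒳 × 𝒴 → ℝ) {W : 𝒳 × 𝒴 → 𝒳₁ × 𝒳₂ × 𝒰 → ℝ}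
    (hW : ∀ s, W s ∈ stdSimplex ℝ (𝒳₁ × 𝒳₂ × 𝒰)) :
    law (joint P W) (fun ω => (ω.1, ω.2.1)) = P := by
  classical
  funext ⟨x, y⟩
  rw [← sum_joint P hW x y]
  simp only [law]
  rw [Fintype.sum_prod_type, Finset.sum_eq_single x, Fintype.sum_prod_type,
    Finset.sum_eq_single y]
  · simp
  · intro y' _ hy; simp [hy]
  · simp
  · intro x' _ hx; simp [hx]
  · simp

/-- A rate triple belongs to the single-letter region as soon as some random variables on some
finite probability space satisfy the constraints. -/
lemma mem_regionWith_of_random_variables {P : 𝒳 × 𝒴 → ℝ} {d₁ : 𝒳 → 𝒳₁ → ℝ} {d₂ : 𝒳 → 𝒳₂ → ℝ}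
    {D₁ D₂ : ℝ} {R : ℝ × ℝ × ℝ} {p : Ω → ℝ} (hp : p ∈ stdSimplex ℝ Ω)
    (X : Ω → 𝒳) (Y : Ω → 𝒴) (X₁ : Ω → 𝒳₁) (X₂ : Ω → 𝒳₂) (U : Ω → 𝒰)
    (hlaw : law p (fun ω => (X ω, Y ω)) = P)
    (hD₁ : ∑ ω, p ω * d₁ (X ω) (X₁ ω) ≤ D₁) (hD₂ : ∑ ω, p ω * d₂ (X ω) (X₂ ω) ≤ D₂)
    (h₁ : cmi p X (fun ω => (X₁ ω, U ω)) Y ≤ R.1)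
    (h₂ : ent p (fun ω => (X ω, Y ω)) + ent p U - ent p (fun ω => ((X ω, Y ω), U ω)) ≤ R.2.1)
    (h₃ : cmi p X X₂ U ≤ R.2.2) : R ∈ regionWith 𝒰 P d₁ d₂ D₁ D₂ := by
  have : Nonempty (𝒳₁ × 𝒳₂ × 𝒰) :=
    (nonempty_of_mem_stdSimplex hp).map fun ω => (X₁ ω, X₂ ω, U ω)
  obtain ⟨W, hW, hq⟩ := exists_disintegration
    (law p (fun ω => ((X ω, Y ω), X₁ ω, X₂ ω, U ω))) (law_nonneg hp.1 _)
  have hj : joint P W = law p (fun ω => (X ω, Y ω, X₁ ω, X₂ ω, U ω)) := by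
    funext ⟨x, y, a, b, u⟩
    have := hq (x, y) (a, b, u)
    rw [sum_law_prod p (fun ω => (X ω, Y ω)) (fun ω => (X₁ ω, X₂ ω, U ω)), hlaw] at this
    simp only [joint]
    rw [← this]
    exact law_congr fun ω => by simp [and_assoc]
  refine ⟨W, hW, ?_, ?_⟩
  · rw [hj]
    exact ⟨(sum_law_mul p (fun ω => (X ω, Y ω, X₁ ω, X₂ ω, U ω))
        (fun ω => d₁ ω.1 ω.2.2.1)).le.trans hD₁,
      (sum_law_mul p (fun ω => (X ω, Y ω, X₁ ω, X₂ ω, U ω))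
        (fun ω => d₂ ω.1 ω.2.2.2.1)).le.trans hD₂⟩
  · rw [hj, rateConstraints_iff (law_nonneg hp.1 _)]
    simp only [cmi, ent_law] at h₁ h₃ ⊢
    exact ⟨h₁, h₂, h₃⟩

end SingleLetter

variable [Fintype ι]

lemma mixture_mem_stdSimplex {w : ι → ℝ} {r : ι → Ω → ℝ} (hw : w ∈ stdSimplex ℝ ι)
    (hr : ∀ i, r i ∈ stdSimplex ℝ Ω) :
    (fun x : ι × Ω => w x.1 * r x.1 x.2) ∈ stdSimplex ℝ (ι × Ω) := by
  refine ⟨fun x => mul_nonneg (hw.1 _) ((hr _).1 _), ?_⟩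
  simp only [Fintype.sum_prod_type]
  simp only [← Finset.mul_sum, (hr _).2, mul_one, hw.2]

lemma law_mixture (w : ι → ℝ) (r : ι → Ω → ℝ) (A : ι → Ω → α) (a : α) :
    law (fun x : ι × Ω => w x.1 * r x.1 x.2) (fun x => A x.1 x.2) a =
      ∑ i, w i * law (r i) (A i) a := by
  simp only [law, Fintype.sum_prod_type, Finset.mul_sum, mul_ite, mul_zero]

section Mixture

variable {w : ι → ℝ} {r : ι → Ω → ℝ} (hw : ∀ i, 0 ≤ w i) (hr : ∀ i, r i ∈ stdSimplex ℝ Ω)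
  (A : ι → Ω → α) (B : ι → Ω → β) (C : ι → Ω → γ) (V : ι → Ω → 𝒱) {U : ι × Ω → 𝒰}
  (hU : ∀ x x', U x = U x' ↔ x.1 = x'.1 ∧ V x.1 x.2 = V x'.1 x'.2)
include hw hr hU

/-! In the next lemmas the sample point `(i, ω)` is drawn from the mixture of the `r i` with weights
`w i`, and `U` carries the same information as the pair of `i` and `V i`. -/

lemma mutualInfo_mixture :
    ent (fun x : ι × Ω => w x.1 * r x.1 x.2) (fun x => A x.1 x.2) +
      ent (fun x : ι × Ω => w x.1 * r x.1 x.2) U -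
      ent (fun x : ι × Ω => w x.1 * r x.1 x.2) (fun x => (A x.1 x.2, U x)) =
    ent (fun x : ι × Ω => w x.1 * r x.1 x.2) (fun x => A x.1 x.2) +
      ∑ i, w i * (ent (r i) (V i) - ent (r i) (fun ω => (A i ω, V i ω))) := by
  have e1 := ent_mixture hw hr V
  have e2 := ent_mixture hw hr (fun i ω => (A i ω, V i ω))
  have c1 : ent (fun x : ι × Ω => w x.1 * r x.1 x.2) U = _ :=
    (ent_congr fun x x' => by rw [hU, Prod.mk.injEq]).trans e1
  have c2 : ent (fun x : ι × Ω => w x.1 * r x.1 x.2) (fun x => (A x.1 x.2, U x)) = _ :=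
    (ent_congr fun x x' => by simp only [hU, Prod.mk.injEq]; tauto).trans e2
  rw [c1, c2]
  simp only [mul_sub, Finset.sum_sub_distrib]
  ring

lemma cmi_mixture : cmi (fun x : ι × Ω => w x.1 * r x.1 x.2) (fun x => A x.1 x.2)
      (fun x => B x.1 x.2) U = ∑ i, w i * cmi (r i) (A i) (B i) (V i) := by
  have e1 := ent_mixture hw hr V
  have e2 := ent_mixture hw hr (fun i ω => (A i ω, V i ω))
  have e3 := ent_mixture hw hr (fun i ω => (B i ω, V i ω))
  have e4 := ent_mixture hw hr (fun i ω => (A i ω, B i ω, V i ω))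
  have c1 : ent (fun x : ι × Ω => w x.1 * r x.1 x.2) U = _ :=
    (ent_congr fun x x' => by rw [hU, Prod.mk.injEq]).trans e1
  have c2 : ent (fun x : ι × Ω => w x.1 * r x.1 x.2) (fun x => (A x.1 x.2, U x)) = _ :=
    (ent_congr fun x x' => by simp only [hU, Prod.mk.injEq]; tauto).trans e2
  have c3 : ent (fun x : ι × Ω => w x.1 * r x.1 x.2) (fun x => (B x.1 x.2, U x)) = _ :=
    (ent_congr fun x x' => by simp only [hU, Prod.mk.injEq]; tauto).trans e3
  have c4 : ent (fun x : ι × Ω => w x.1 * r x.1 x.2)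
      (fun x => (A x.1 x.2, B x.1 x.2, U x)) = _ :=
    (ent_congr fun x x' => by simp only [hU, Prod.mk.injEq]; tauto).trans e4
  rw [cmi, c1, c2, c3, c4]
  simp only [cmi, mul_sub, mul_add, Finset.sum_sub_distrib, Finset.sum_add_distrib]
  ring

lemma cmi_mixture_right : cmi (fun x : ι × Ω => w x.1 * r x.1 x.2) (fun x => A x.1 x.2)
      (fun x => (B x.1 x.2, U x)) (fun x => C x.1 x.2) =
    ent (fun x : ι × Ω => w x.1 * r x.1 x.2) (fun x => (A x.1 x.2, C x.1 x.2)) -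
      ent (fun x : ι × Ω => w x.1 * r x.1 x.2) (fun x => C x.1 x.2) +
      ∑ i, w i * (ent (r i) (fun ω => ((B i ω, V i ω), C i ω)) -
        ent (r i) (fun ω => (A i ω, (B i ω, V i ω), C i ω))) := by
  have e1 := ent_mixture hw hr (fun i ω => ((B i ω, V i ω), C i ω))
  have e2 := ent_mixture hw hr (fun i ω => (A i ω, (B i ω, V i ω), C i ω))
  have c1 : ent (fun x : ι × Ω => w x.1 * r x.1 x.2)
      (fun x => ((B x.1 x.2, U x), C x.1 x.2)) = _ :=
    (ent_congr fun x x' => by simp only [hU, Prod.mk.injEq]; tauto).trans e1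
  have c2 : ent (fun x : ι × Ω => w x.1 * r x.1 x.2)
      (fun x => (A x.1 x.2, (B x.1 x.2, U x), C x.1 x.2)) = _ :=
    (ent_congr fun x x' => by simp only [hU, Prod.mk.injEq]; tauto).trans e2
  rw [cmi, c1, c2]
  simp only [mul_sub, Finset.sum_sub_distrib]
  ring

end Mixture

end Rates

section Support

/-- A conical combination of vectors in `ℝ^ι` that lie in an affine hyperplane off the origin can be
replaced by one with at most `|ι|` nonzero coefficients that does not increase a given linear cost:
a basic optimal solution of a linear program. -/
lemma exists_small_support {𝒰 ι : Type*} [Fintype 𝒰] [Fintype ι] (v : 𝒰 → ι → ℝ) (c : 𝒰 → ℝ)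
    (l : ι → ℝ) (hl : ∀ u, ∑ i, l i * v u i = 1) (w : 𝒰 → ℝ) (hw : ∀ u, 0 ≤ w u) :
    ∃ w' : 𝒰 → ℝ, (∀ u, 0 ≤ w' u) ∧ (∀ i, ∑ u, w' u * v u i = ∑ u, w u * v u i) ∧
      ∑ u, w' u * c u ≤ ∑ u, w u * c u ∧ Nat.card {u // w' u ≠ 0} ≤ Fintype.card ι := by
  classical
  induction hN : Nat.card {u // w u ≠ 0} using Nat.strong_induction_on generalizing w with
  | _ N ih =>
  by_cases hle : Nat.card {u // w u ≠ 0} ≤ Fintype.card ι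
  · exact ⟨w, hw, fun _ => rfl, le_rfl, hle⟩
  have hdep : ¬ LinearIndependent ℝ (fun u : {u // w u ≠ 0} => v u) := by
    intro h
    apply hle
    simpa [Nat.card_eq_fintype_card] using h.fintype_card_le_finrank
  obtain ⟨g, hg, hg0⟩ : ∃ g : 𝒰 → ℝ, ((∀ u, w u = 0 → g u = 0) ∧ (∀ i, ∑ u, g u * v u i = 0) ∧
      ∑ u, g u * c u ≤ 0) ∧ ∃ u, g u ≠ 0 := by
    obtain ⟨g, hg, ⟨u₀, hu₀⟩, hg0⟩ := Fintype.not_linearIndependent_iff.1 hdep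
    have key : ∃ g : 𝒰 → ℝ, ((∀ u, w u = 0 → g u = 0) ∧ (∀ i, ∑ u, g u * v u i = 0)) ∧
        ∃ u, g u ≠ 0 := by
      refine ⟨fun u => if h : w u ≠ 0 then g ⟨u, h⟩ else 0, ⟨fun u h => by simp [h], fun i => ?_⟩,
        u₀, by simpa [hu₀] using hg0⟩
      have := congrFun hg i
      simp only [Finset.sum_apply, Pi.smul_apply, smul_eq_mul, Pi.zero_apply] at this
      have hsub : ∑ u, (if h : w u ≠ 0 then g ⟨u, h⟩ else 0) * v u i =
          ∑ u : {u // w u ≠ 0}, (if h : w u ≠ 0 then g ⟨u, h⟩ else 0) * v u i := by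
        rw [← Finset.sum_subtype (Finset.univ.filter fun u => w u ≠ 0) (by simp)
          (fun u => (if h : w u ≠ 0 then g ⟨u, h⟩ else 0) * v u i)]
        refine (Finset.sum_filter_of_ne (p := fun u => w u ≠ 0) fun u _ hu h0 => hu ?_).symm
        simp [h0]
      refine hsub.trans (Eq.trans (Finset.sum_congr rfl fun u _ => ?_) this)
      rw [dif_pos u.2]
    obtain ⟨g, ⟨h1, h2⟩, h3⟩ := key
    rcases le_total (∑ u, g u * c u) 0 with h | h
    · exact ⟨g, ⟨h1, h2, h⟩, h3⟩
    · refine ⟨fun u => -g u, ⟨fun u hu => by simp [h1 u hu], fun i => ?_, ?_⟩, ?_⟩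
      · simp [h2]
      · simpa using h
      · simpa using h3
  obtain ⟨hs, hv, hc⟩ := hg
  have hsum : ∑ u, g u = 0 := by
    have : ∑ u, g u = ∑ i, l i * ∑ u, g u * v u i := by
      simp only [Finset.mul_sum]
      rw [Finset.sum_comm]
      refine Finset.sum_congr rfl fun u _ => ?_
      simp only [mul_left_comm _ (g u), ← Finset.mul_sum, hl, mul_one]
    rw [this]; simp [hv]
  obtain ⟨u₁, hu₁⟩ : ∃ u, g u < 0 := by
    by_contra! h
    obtain ⟨u, hu⟩ := hg0
    exact hu ((Finset.sum_eq_zero_iff_of_nonneg fun u _ => h u).1 hsum u (Finset.mem_univ u))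
  obtain ⟨u₂, hu₂, hmin⟩ := Finset.exists_min_image (Finset.univ.filter fun u => g u < 0)
    (fun u => w u / -g u) ⟨u₁, by simp [hu₁]⟩
  simp only [Finset.mem_filter, Finset.mem_univ, true_and] at hu₂ hmin
  -- The largest step in the direction `g` that keeps the coefficients nonnegative.
  set t := w u₂ / -g u₂ with ht
  have ht0 : 0 ≤ t := div_nonneg (hw _) (by linarith)
  have hw' : ∀ u, 0 ≤ w u + t * g u := by
    intro u
    rcases lt_or_ge (g u) 0 with h | h
    · have := hmin u h
      rw [le_div_iff₀ (by linarith)] at this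
      linarith
    · have := hw u
      positivity
  have hz : w u₂ + t * g u₂ = 0 := by
    rw [ht]; field_simp [hu₂.ne]; ring
  have hlt : Nat.card {u // w u + t * g u ≠ 0} < N := by
    rw [← hN, Nat.card_eq_fintype_card, Nat.card_eq_fintype_card, Fintype.card_subtype,
      Fintype.card_subtype]
    refine Finset.card_lt_card ⟨fun u hu => ?_, fun h => ?_⟩
    · simp only [Finset.mem_filter, Finset.mem_univ, true_and] at hu ⊢
      intro h0
      exact hu (by rw [h0, hs u h0]; ring)
    · have := @h u₂ (by
        simp only [Finset.mem_filter, Finset.mem_univ, true_and]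
        exact fun h0 => hu₂.ne (hs u₂ h0))
      simp [hz] at this
  obtain ⟨w', h1, h2, h3, h4⟩ := ih _ hlt (fun u => w u + t * g u) hw' rfl
  refine ⟨w', h1, fun i => ?_, h3.trans ?_, h4⟩
  · rw [h2 i]
    simp only [add_mul, Finset.sum_add_distrib, mul_assoc, ← Finset.mul_sum, hv]
    simp
  · simp only [add_mul, Finset.sum_add_distrib, mul_assoc, ← Finset.mul_sum]
    nlinarith

end Support

/-! ### Closedness of the region and the cardinality bound -/

section Closed

variable {𝒳 𝒴 𝒳₁ 𝒳₂ 𝒰 : Type*}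
  [Fintype 𝒳] [Fintype 𝒴] [Fintype 𝒳₁] [Fintype 𝒳₂] [Fintype 𝒰]

lemma ent_eq_sum_negMulLog {Ω α : Type*} [Fintype Ω] [Fintype α] (p : Ω → ℝ) (A : Ω → α) :
    ent p A = (∑ a, Real.negMulLog (law p A a)) / Real.log 2 := by
  rw [ent, ← sum_law_mul p A (fun a => Real.logb 2 (law p A a)), Finset.sum_div,
    ← Finset.sum_neg_distrib]
  refine Finset.sum_congr rfl fun a _ => ?_
  rw [Real.negMulLog, Real.logb]; ring

lemma continuous_joint {𝒳 𝒴 𝒳₁ 𝒳₂ 𝒰 : Type*} (P : 𝒳 × 𝒴 → ℝ) (ω : 𝒳 × 𝒴 × 𝒳₁ × 𝒳₂ × 𝒰) :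
    Continuous fun W : 𝒳 × 𝒴 → 𝒳₁ × 𝒳₂ × 𝒰 → ℝ => joint P W ω := by
  simp only [joint]
  fun_prop

lemma continuous_ent_joint {α : Type*} [Fintype α] (P : 𝒳 × 𝒴 → ℝ)
    (A : 𝒳 × 𝒴 × 𝒳₁ × 𝒳₂ × 𝒰 → α) :
    Continuous fun W : 𝒳 × 𝒴 → 𝒳₁ × 𝒳₂ × 𝒰 → ℝ => ent (joint P W) A := by
  simp only [ent_eq_sum_negMulLog, law]
  refine Continuous.div_const (continuous_finsetSum _ fun a _ =>
    Real.continuous_negMulLog.comp (continuous_finsetSum _ fun ω _ => ?_)) _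
  split_ifs
  · exact continuous_joint P ω
  · exact continuous_const

lemma continuous_cmi_joint {α β γ : Type*} [Fintype α] [Fintype β] [Fintype γ] (P : 𝒳 × 𝒴 → ℝ)
    (A : 𝒳 × 𝒴 × 𝒳₁ × 𝒳₂ × 𝒰 → α) (B : 𝒳 × 𝒴 × 𝒳₁ × 𝒳₂ × 𝒰 → β) (C : 𝒳 × 𝒴 × 𝒳₁ × 𝒳₂ × 𝒰 → γ) :
    Continuous fun W : 𝒳 × 𝒴 → 𝒳₁ × 𝒳₂ × 𝒰 → ℝ => cmi (joint P W) A B C :=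
  (((continuous_ent_joint P _).add (continuous_ent_joint P _)).sub
    (continuous_ent_joint P _)).sub (continuous_ent_joint P _)

/-- The set of all rate-distortion tuples that are obtained with a fixed alphabet of `U` is closed,
because the conditional distributions `W` form a compact set. -/
lemma isClosed_setOf_mem_regionWith {P : 𝒳 × 𝒴 → ℝ} (hP : P ∈ stdSimplex ℝ (𝒳 × 𝒴))
    (d₁ : 𝒳 → 𝒳₁ → ℝ) (d₂ : 𝒳 → 𝒳₂ → ℝ) :
    IsClosed {t : (ℝ × ℝ × ℝ) × ℝ × ℝ | t.1 ∈ regionWith 𝒰 P d₁ d₂ t.2.1 t.2.2} := by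
  set K : Set (𝒳 × 𝒴 → 𝒳₁ × 𝒳₂ × 𝒰 → ℝ) :=
    Set.univ.pi fun _ => stdSimplex ℝ (𝒳₁ × 𝒳₂ × 𝒰) with hK
  have : CompactSpace K := isCompact_iff_compactSpace.1
    (isCompact_univ_pi fun _ => isCompact_stdSimplex ℝ _)
  have hKW : ∀ W : K, ∀ s, W.1 s ∈ stdSimplex ℝ (𝒳₁ × 𝒳₂ × 𝒰) := fun W s => W.2 s trivial
  have hK' : Continuous fun t : K × ((ℝ × ℝ × ℝ) × ℝ × ℝ) => t.1.1 :=
    continuous_subtype_val.comp continuous_fst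
  have hj : ∀ ω, Continuous fun t : K × ((ℝ × ℝ × ℝ) × ℝ × ℝ) => joint P t.1.1 ω := fun ω =>
    (continuous_joint P ω).comp hK'
  have hcl : IsClosed {t : K × ((ℝ × ℝ × ℝ) × ℝ × ℝ) |
      DistortionConstraints (joint P t.1.1) d₁ d₂ t.2.2.1 t.2.2.2 ∧
        RateConstraints (joint P t.1.1) t.2.1} := by
    simp only [rateConstraints_iff (joint_mem_stdSimplex hP (hKW _)).1, DistortionConstraints,
      Set.ofPred_and]
    refine ((isClosed_le ?_ ?_).inter (isClosed_le ?_ ?_)).inter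
      ((isClosed_le ?_ ?_).inter ((isClosed_le ?_ ?_).inter (isClosed_le ?_ ?_)))
    · exact continuous_finsetSum _ fun ω _ => (hj ω).mul_const _
    · fun_prop
    · exact continuous_finsetSum _ fun ω _ => (hj ω).mul_const _
    · fun_prop
    · exact (continuous_cmi_joint P _ _ _).comp hK'
    · fun_prop
    · exact (((continuous_ent_joint P _).add (continuous_ent_joint P _)).sub
        (continuous_ent_joint P _)).comp hK'
    · fun_prop
    · exact (continuous_cmi_joint P _ _ _).comp hK'
    · fun_prop
  convert isClosedMap_snd_of_compactSpace _ hcl using 1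
  ext t
  constructor
  · rintro ⟨W, hW, h⟩
    exact ⟨(⟨W, fun s _ => hW s⟩, t), h, rfl⟩
  · rintro ⟨⟨W, t'⟩, h, rfl⟩
    exact ⟨W.1, hKW W, h⟩

lemma isClosed_setOf_mem_boundedRegion (K : ℕ) {P : 𝒳 × 𝒴 → ℝ} (hP : P ∈ stdSimplex ℝ (𝒳 × 𝒴))
    (d₁ : 𝒳 → 𝒳₁ → ℝ) (d₂ : 𝒳 → 𝒳₂ → ℝ) :
    IsClosed {t : (ℝ × ℝ × ℝ) × ℝ × ℝ | t.1 ∈ boundedRegion K P d₁ d₂ t.2.1 t.2.2} := by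
  have : {t : (ℝ × ℝ × ℝ) × ℝ × ℝ | t.1 ∈ boundedRegion K P d₁ d₂ t.2.1 t.2.2} =
      ⋃ k ∈ Set.Iic K, {t : (ℝ × ℝ × ℝ) × ℝ × ℝ |
        t.1 ∈ regionWith (Fin k) P d₁ d₂ t.2.1 t.2.2} := by
    ext t; simp [boundedRegion]
  rw [this]
  exact (Set.finite_Iic K).isClosed_biUnion fun k _ => isClosed_setOf_mem_regionWith hP d₁ d₂

end Closed

section Cardinality

variable {𝒳 𝒴 𝒳₁ 𝒳₂ 𝒰 : Type*}
  [Fintype 𝒳] [Fintype 𝒴] [Fintype 𝒳₁] [Fintype 𝒳₂] [Fintype 𝒰]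

/-- The cardinality bound. Conditioning on `U = u`, the three rates are affine in the law of `U`, and
the law of `(X, Y, X̂₁, X̂₂)` is linear in it. Keeping the latter and two of the rates fixed, a basic
optimal solution of the linear program that minimizes the third rate has small support. -/
lemma regionWith_subset_boundedRegion {P : 𝒳 × 𝒴 → ℝ} (hP : P ∈ stdSimplex ℝ (𝒳 × 𝒴))
    (d₁ : 𝒳 → 𝒳₁ → ℝ) (d₂ : 𝒳 → 𝒳₂ → ℝ) (D₁ D₂ : ℝ) :
    regionWith 𝒰 P d₁ d₂ D₁ D₂ ⊆ boundedRegion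
      (Fintype.card 𝒳 * Fintype.card 𝒴 * Fintype.card 𝒳₁ * Fintype.card 𝒳₂ + 2)
      P d₁ d₂ D₁ D₂ := by
  classical
  rintro R ⟨W, hW, hD, hR⟩
  have hq := joint_mem_stdSimplex hP hW
  rw [rateConstraints_iff hq.1] at hR
  have : Nonempty (𝒳 × 𝒴 × 𝒳₁ × 𝒳₂) :=
    (nonempty_of_mem_stdSimplex hq).map fun ω => (ω.1, ω.2.1, ω.2.2.1, ω.2.2.2.1)
  let e : 𝒳 × 𝒴 × 𝒳₁ × 𝒳₂ × 𝒰 ≃ 𝒰 × 𝒳 × 𝒴 × 𝒳₁ × 𝒳₂ :=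
    { toFun := fun ω => (ω.2.2.2.2, ω.1, ω.2.1, ω.2.2.1, ω.2.2.2.1)
      invFun := fun ω => (ω.2.1, ω.2.2.1, ω.2.2.2.1, ω.2.2.2.2, ω.1)
      left_inv := fun _ => rfl
      right_inv := fun _ => rfl }
  obtain ⟨r, hr, hqr⟩ := exists_disintegration (fun x => joint P W (e.symm x)) (fun _ => hq.1 _)
  set w : 𝒰 → ℝ := fun u => ∑ b, joint P W (e.symm (u, b)) with hw
  have hw0 : ∀ u, 0 ≤ w u := fun u => Finset.sum_nonneg fun _ _ => hq.1 _
  have hjoint : joint P W = fun ω => (fun x : 𝒰 × 𝒳 × 𝒴 × 𝒳₁ × 𝒳₂ => w x.1 * r x.1 x.2) (e ω) :=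
    funext fun ω => hqr (e ω).1 (e ω).2
  -- The constraints in terms of the mixture of the `r u` with weights `w u`.
  have hlaw : ∀ z, P z = ∑ u, w u * law (r u) (fun ω => (ω.1, ω.2.1)) z := by
    intro z
    rw [← law_mixture w r (fun _ ω => (ω.1, ω.2.1)), ← congrFun (law_joint P hW) z, hjoint]
    exact law_comp_equiv e (fun x => w x.1 * r x.1 x.2) (fun x => (x.2.1, x.2.2.1)) z
  have hsum : ∀ φ : 𝒳 × 𝒴 × 𝒳₁ × 𝒳₂ → ℝ,
      ∑ ω, joint P W ω * φ (e ω).2 = ∑ u, w u * ∑ b, r u b * φ b := by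
    intro φ
    rw [hjoint]
    refine (e.sum_comp (fun x : 𝒰 × 𝒳 × 𝒴 × 𝒳₁ × 𝒳₂ => w x.1 * r x.1 x.2 * φ x.2)).trans ?_
    rw [Fintype.sum_prod_type]
    simp only [mul_assoc, Finset.mul_sum]
  have hR₁ := (cmi_comp_equiv e (fun x => w x.1 * r x.1 x.2) (fun x => x.2.1)
    (fun x => (x.2.2.2.1, x.1)) (fun x => x.2.2.1)).symm.trans_le (hjoint ▸ hR.1)
  have hR₃ := (cmi_comp_equiv e (fun x => w x.1 * r x.1 x.2) (fun x => x.2.1)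
    (fun x => x.2.2.2.2) (fun x => x.1)).symm.trans_le (hjoint ▸ hR.2.2)
  have hR₂ : ent (fun x : 𝒰 × 𝒳 × 𝒴 × 𝒳₁ × 𝒳₂ => w x.1 * r x.1 x.2) (fun x => (x.2.1, x.2.2.1)) +
      ent (fun x : 𝒰 × 𝒳 × 𝒴 × 𝒳₁ × 𝒳₂ => w x.1 * r x.1 x.2) (fun x => x.1) -
      ent (fun x : 𝒰 × 𝒳 × 𝒴 × 𝒳₁ × 𝒳₂ => w x.1 * r x.1 x.2)
        (fun x => ((x.2.1, x.2.2.1), x.1)) ≤ R.2.1 := by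
    rw [← ent_comp_equiv e, ← ent_comp_equiv e, ← ent_comp_equiv e]
    exact hjoint ▸ hR.2.1
  rw [cmi_mixture_right hw0 hr (fun _ ω => ω.1) (fun _ ω => ω.2.2.1) (fun _ ω => ω.2.1)
    (fun _ _ => ()) (U := fun x => x.1) (by simp)] at hR₁
  rw [mutualInfo_mixture hw0 hr (fun _ ω => (ω.1, ω.2.1)) (fun _ _ => ()) (U := fun x => x.1)
    (by simp)] at hR₂
  rw [cmi_mixture hw0 hr (fun _ ω => ω.1) (fun _ ω => ω.2.2.2) (fun _ _ => ())
    (U := fun x => x.1) (by simp)] at hR₃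
  obtain ⟨w', hw'0, hv, hc, hcard⟩ := exists_small_support
    (fun u => Sum.elim (r u) ![ent (r u) (fun _ => ()) - ent (r u) (fun ω => ((ω.1, ω.2.1), ())),
      cmi (r u) (fun ω => ω.1) (fun ω => ω.2.2.2) (fun _ => ())])
    (fun u => ent (r u) (fun ω => ((ω.2.2.1, ()), ω.2.1)) -
      ent (r u) (fun ω => (ω.1, (ω.2.2.1, ()), ω.2.1)))
    (Sum.elim 1 0) (fun u => by simp [(hr u).2]) w hw0
  have hlin : ∀ φ : 𝒳 × 𝒴 × 𝒳₁ × 𝒳₂ → ℝ,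
      ∑ u, w' u * ∑ b, r u b * φ b = ∑ u, w u * ∑ b, r u b * φ b := by
    intro φ
    have h := fun ω => hv (Sum.inl ω)
    simp only [Sum.elim_inl] at h
    simp only [Finset.mul_sum, ← mul_assoc]
    rw [Finset.sum_comm]
    conv_rhs => rw [Finset.sum_comm]
    simp only [← Finset.sum_mul, h]
  have hv₂ := hv (Sum.inr 0)
  have hv₃ := hv (Sum.inr 1)
  simp only [Sum.elim_inr, Matrix.cons_val_zero, Matrix.cons_val_one] at hv₂ hv₃
  have hwsum : ∑ u, w' u = 1 := by
    have h1 := hlin fun _ => 1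
    have h2 := hsum fun _ => 1
    simp only [mul_one, (hr _).2, hq.2] at h1 h2
    rw [h1, ← h2]
  -- The letters of positive weight are relabelled by `Fin k`.
  set k := Nat.card {u // w' u ≠ 0} with hk
  let f : Fin k ≃ {u // w' u ≠ 0} := (Finite.equivFin _).symm
  have hf : ∀ g : 𝒰 → ℝ, ∑ i, w' (f i) * g (f i) = ∑ u, w' u * g u := by
    intro g
    rw [f.sum_comp (fun u => w' u * g u), ← Finset.sum_subtype (Finset.univ.filter fun u => w' u ≠ 0)
      (by simp) (fun u => w' u * g u)]
    exact Finset.sum_filter_of_ne (p := fun u => w' u ≠ 0) fun u _ hu h0 => hu (by simp [h0])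
  have hw'' : (fun i => w' (f i)) ∈ stdSimplex ℝ (Fin k) :=
    ⟨fun i => hw'0 _, by simpa [hwsum] using hf fun _ => 1⟩
  have hr' : ∀ i, r (f i) ∈ stdSimplex ℝ (𝒳 × 𝒴 × 𝒳₁ × 𝒳₂) := fun i => hr _
  have hlaw' : law (fun x : Fin k × 𝒳 × 𝒴 × 𝒳₁ × 𝒳₂ => w' (f x.1) * r (f x.1) x.2)
      (fun x => (x.2.1, x.2.2.1)) = P := by
    funext z
    rw [hlaw, law_mixture (fun i => w' (f i)) (fun i => r (f i)) (fun _ ω => (ω.1, ω.2.1)),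
      hf fun u => law (r u) (fun ω => (ω.1, ω.2.1)) z]
    have h : ∀ u, law (r u) (fun ω => (ω.1, ω.2.1)) z =
        ∑ b, r u b * if (b.1, b.2.1) = z then 1 else 0 := fun u => by
      simp only [law, mul_ite, mul_one, mul_zero]
      congr!
    simp only [h]
    exact hlin _
  have hlaw₀ : law (fun x : 𝒰 × 𝒳 × 𝒴 × 𝒳₁ × 𝒳₂ => w x.1 * r x.1 x.2)
      (fun x => (x.2.1, x.2.2.1)) = P := by
    funext z
    rw [hlaw, law_mixture w r (fun _ ω => (ω.1, ω.2.1))]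
  have hent := ent_congr_law (hlaw'.trans hlaw₀.symm) fun z => z
  have hentY := ent_congr_law (hlaw'.trans hlaw₀.symm) fun z => z.2
  have hdist : ∀ φ : 𝒳 × 𝒴 × 𝒳₁ × 𝒳₂ → ℝ,
      ∑ x : Fin k × 𝒳 × 𝒴 × 𝒳₁ × 𝒳₂, w' (f x.1) * r (f x.1) x.2 * φ x.2 =
        ∑ ω, joint P W ω * φ (e ω).2 := by
    intro φ
    rw [hsum, ← hlin, ← hf fun u => ∑ b, r u b * φ b, Fintype.sum_prod_type]
    simp only [mul_assoc, Finset.mul_sum]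
  have hmem : R ∈ regionWith (Fin k) P d₁ d₂ D₁ D₂ := by
    refine mem_regionWith_of_random_variables (mixture_mem_stdSimplex hw'' hr')
      (fun x => x.2.1) (fun x => x.2.2.1) (fun x => x.2.2.2.1) (fun x => x.2.2.2.2) (fun x => x.1)
      hlaw' ((hdist fun ω => d₁ ω.1 ω.2.2.1).trans_le hD.1)
      ((hdist fun ω => d₂ ω.1 ω.2.2.2).trans_le hD.2) ?_ ?_ ?_
    · rw [cmi_mixture_right hw''.1 hr' (fun _ ω => ω.1) (fun _ ω => ω.2.2.1) (fun _ ω => ω.2.1)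
        (fun _ _ => ()) (U := fun x => x.1) (by simp), hent, hentY,
        hf fun u => ent (r u) (fun ω => ((ω.2.2.1, ()), ω.2.1)) -
          ent (r u) (fun ω => (ω.1, (ω.2.2.1, ()), ω.2.1))]
      linarith
    · rw [mutualInfo_mixture hw''.1 hr' (fun _ ω => (ω.1, ω.2.1)) (fun _ _ => ())
        (U := fun x => x.1) (by simp), hent,
        hf fun u => ent (r u) (fun _ => ()) - ent (r u) (fun ω => ((ω.1, ω.2.1), ()))]
      linarith
    · rw [cmi_mixture hw''.1 hr' (fun _ ω => ω.1) (fun _ ω => ω.2.2.2) (fun _ _ => ())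
        (U := fun x => x.1) (by simp),
        hf fun u => cmi (r u) (fun ω => ω.1) (fun ω => ω.2.2.2) (fun _ => ())]
      linarith
  refine Set.mem_iUnion₂.2 ⟨k, hcard.trans (le_of_eq ?_), hmem⟩
  simp only [Fintype.card_sum, Fintype.card_prod, Fintype.card_fin]
  ring

end Cardinality

/-! ### The converse -/

section Converse

/-- The first `k` letters of a block, as a block in which the other letters are erased. -/
def prefixBlock {α : Type*} {n : ℕ} (k : ℕ) (ω : Fin n → α) : Fin n → Option α :=
  fun j => if (j : ℕ) < k then some (ω j) else none

lemma prefixBlock_eq_iff {α : Type*} {n : ℕ} {k : ℕ} {ω ω' : Fin n → α} :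
    prefixBlock k ω = prefixBlock k ω' ↔ ∀ j : Fin n, (j : ℕ) < k → ω j = ω' j := by
  simp only [prefixBlock, funext_iff]
  refine forall_congr' fun j => ?_
  by_cases h : (j : ℕ) < k <;> simp [h]

lemma prefixBlock_succ_eq_iff {α : Type*} {n : ℕ} {i : Fin n} {ω ω' : Fin n → α} :
    prefixBlock (i + 1 : ℕ) ω = prefixBlock (i + 1 : ℕ) ω' ↔
      prefixBlock i ω = prefixBlock i ω' ∧ ω i = ω' i := by
  simp only [prefixBlock_eq_iff]
  constructor
  · exact fun h => ⟨fun j hj => h j (by omega), h i (by omega)⟩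
  · rintro ⟨h1, h2⟩ j hj
    rcases (Nat.lt_succ_iff_lt_or_eq.1 hj) with h | h
    · exact h1 j h
    · rwa [Fin.ext h]

lemma prefixBlock_zero_eq {α : Type*} {n : ℕ} (ω ω' : Fin n → α) :
    prefixBlock 0 ω = prefixBlock 0 ω' := prefixBlock_eq_iff.2 (by simp)

lemma prefixBlock_full_eq_iff {α : Type*} {n : ℕ} {ω ω' : Fin n → α} :
    prefixBlock n ω = prefixBlock n ω' ↔ ω = ω' := by
  rw [prefixBlock_eq_iff, funext_iff]; simp

lemma sum_fin_sub (F : ℕ → ℝ) (n : ℕ) : ∑ i : Fin n, (F (i + 1) - F i) = F n - F 0 := by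
  rw [Fin.sum_univ_eq_sum_range (fun i => F (i + 1) - F i), Finset.sum_range_sub]

variable {𝒳 𝒴 𝒳₁ 𝒳₂ : Type*} [Fintype 𝒳] [Fintype 𝒴] {n M₁ M₂ M₃ : ℕ}

lemma expectedDistortion_eq {𝒵 : Type*} (P : 𝒳 × 𝒴 → ℝ) (d : 𝒳 → 𝒵 → ℝ)
    (r : (Fin n → 𝒳) → (Fin n → 𝒴) → (Fin n → 𝒵)) :
    expectedDistortion P d r = ∑ ω, iid n P ω * ((1 / (n : ℝ)) *
      ∑ j, d (ω j).1 (r (fun j => (ω j).1) (fun j => (ω j).2) j)) := by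
  rw [expectedDistortion, ← Fintype.sum_prod_type']
  exact ((Equiv.arrowProdEquivProdArrow (Fin n) (fun _ => 𝒳) (fun _ => 𝒴)).sum_comp
    (fun z => (∏ j, P (z.1 j, z.2 j)) * ((1 / (n : ℝ)) * ∑ j, d (z.1 j) (r z.1 z.2 j)))).symm

lemma sum_uniform_time_distortion {𝒵 : Type*} (P : 𝒳 × 𝒴 → ℝ) (d : 𝒳 → 𝒵 → ℝ)
    (r : (Fin n → 𝒳) → (Fin n → 𝒴) → (Fin n → 𝒵)) :
    ∑ x : Fin n × (Fin n → 𝒳 × 𝒴), 1 / (n : ℝ) * iid n P x.2 *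
      d (x.2 x.1).1 (r (fun j => (x.2 j).1) (fun j => (x.2 j).2) x.1) =
        expectedDistortion P d r := by
  rw [expectedDistortion_eq, Fintype.sum_prod_type, Finset.sum_comm]
  refine Finset.sum_congr rfl fun ω _ => ?_
  rw [← mul_assoc, Finset.mul_sum]
  exact Finset.sum_congr rfl fun j _ => by ring

variable [Fintype 𝒳₁] [Fintype 𝒳₂]

/-- The converse for a single code. With `T₂` the message of User 1 to User 2 and a time index
`i` that is uniformly distributed, the auxiliary variable is
`U = (i, T₂, X₁, Y₁, …, X_{i-1}, Y_{i-1})`. -/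
lemma Code.mem_regionWith {P : 𝒳 × 𝒴 → ℝ} (hP : P ∈ stdSimplex ℝ (𝒳 × 𝒴)) (hn : 0 < n)
    (d₁ : 𝒳 → 𝒳₁ → ℝ) (d₂ : 𝒳 → 𝒳₂ → ℝ) {D₁ D₂ : ℝ} {R : ℝ × ℝ × ℝ}
    (c : Code 𝒳 𝒴 𝒳₁ 𝒳₂ n M₁ M₂ M₃)
    (hD₁ : expectedDistortion P d₁ c.recon₁ ≤ D₁) (hD₂ : expectedDistortion P d₂ c.recon₂ ≤ D₂)
    (h₁ : Real.logb 2 M₁ ≤ n * R.1) (h₂ : Real.logb 2 M₂ ≤ n * R.2.1)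
    (h₃ : Real.logb 2 M₃ ≤ n * R.2.2) :
    R ∈ regionWith (Fin n × Fin M₂ × (Fin n → Option (𝒳 × 𝒴))) P d₁ d₂ D₁ D₂ := by
  have hn' : (0 : ℝ) < n := by exact_mod_cast hn
  have hp : iid n P ∈ stdSimplex ℝ (Fin n → 𝒳 × 𝒴) := iid_mem_stdSimplex hP
  have hw : (fun _ => 1 / (n : ℝ)) ∈ stdSimplex ℝ (Fin n) :=
    ⟨fun _ => by positivity, by simp [hn'.ne']⟩
  set xs : (Fin n → 𝒳 × 𝒴) → Fin n → 𝒳 := fun ω j => (ω j).1 with hxs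
  set ys : (Fin n → 𝒳 × 𝒴) → Fin n → 𝒴 := fun ω j => (ω j).2 with hys
  set T₁ : (Fin n → 𝒳 × 𝒴) → Fin M₁ := fun ω => c.f₁ (xs ω, ys ω) with hT₁
  set T₂ : (Fin n → 𝒳 × 𝒴) → Fin M₂ := fun ω => c.f₂ (ys ω, T₁ ω) with hT₂
  set T₃ : (Fin n → 𝒳 × 𝒴) → Fin M₃ := fun ω => c.f₃ (xs ω, ys ω) with hT₃
  set V : Fin n → (Fin n → 𝒳 × 𝒴) → Fin M₂ × (Fin n → Option (𝒳 × 𝒴)) :=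
    fun i ω => (T₂ ω, prefixBlock i ω) with hV
  have hrec₁ : ∀ i ω, c.recon₁ (xs ω) (ys ω) i = c.g₁ (ys ω, T₁ ω) i := fun _ _ => rfl
  have hrec₂ : ∀ i ω, c.recon₂ (xs ω) (ys ω) i = c.g₂ (T₂ ω, T₃ ω) i := fun _ _ => rfl
  have hyi : ∀ {ω ω'}, ys ω = ys ω' → ∀ i, (ω i).2 = (ω' i).2 := fun h i => congrFun h i
  have hlaw : law (fun x : Fin n × (Fin n → 𝒳 × 𝒴) => 1 / (n : ℝ) * iid n P x.2)
      (fun x => ((x.2 x.1).1, (x.2 x.1).2)) = P := by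
    funext z
    rw [law_mixture (fun _ : Fin n => 1 / (n : ℝ)) (fun _ => iid n P)
      (fun i ω => ((ω i).1, (ω i).2))]
    have : ∀ i, law (iid n P) (fun ω => ((ω i).1, (ω i).2)) z = P z := fun i => by
      rw [law_iid_apply hP (fun z => (z.1, z.2))]; exact congrFun (law_id P) z
    simp [this, hn'.ne']
  have hH : ent (iid n P) (fun ω => ω) = n * ent P (fun z => z) := ent_iid hP (fun z => z)
  have hHY : ent (iid n P) ys = n * ent P (fun z => z.2) := ent_iid hP (fun z => z.2)
  have hmix : ent (fun x : Fin n × (Fin n → 𝒳 × 𝒴) => 1 / (n : ℝ) * iid n P x.2)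
      (fun x => ((x.2 x.1).1, (x.2 x.1).2)) = ent P (fun z => z) := by
    exact ent_congr_law (hlaw.trans (law_id P).symm) fun z => z
  have hmixY : ent (fun x : Fin n × (Fin n → 𝒳 × 𝒴) => 1 / (n : ℝ) * iid n P x.2)
      (fun x => (x.2 x.1).2) = ent P (fun z => z.2) := by
    exact ent_congr_law (hlaw.trans (law_id P).symm) fun z => z.2
  -- The message to User 1, given the side information.
  set F : ℕ → ℝ := fun k => ent (iid n P) (fun ω => (T₁ ω, ys ω, prefixBlock k ω)) with hF
  have hF0 : F 0 ≤ n * R.1 + n * ent P (fun z => z.2) := by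
    have e : F 0 = ent (iid n P) (fun ω => (T₁ ω, ys ω)) := ent_congr fun ω ω' => by
      simp [prefixBlock_zero_eq ω ω']
    have e1 := ent_prod_le hp T₁ ys
    have e2 := ent_le_logb_card hp T₁
    rw [Fintype.card_fin] at e2
    rw [e]; linarith
  have hFn : F n = n * ent P (fun z => z) := by
    rw [← hH]
    refine ent_congr fun ω ω' => ?_
    simp only [Prod.mk.injEq, prefixBlock_full_eq_iff]
    exact ⟨fun h => h.2.2, fun h => by simp [h]⟩
  have hF1 : ∀ i : Fin n, ent (iid n P) (fun ω => ((c.recon₁ (xs ω) (ys ω) i, V i ω), (ω i).2)) -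
      ent (iid n P) (fun ω => ((ω i).1, (c.recon₁ (xs ω) (ys ω) i, V i ω), (ω i).2)) ≤
      -(F (i + 1) - F i) := by
    intro i
    have := ent_data_processing hp (A := fun ω => (ω i).1)
      (B := fun ω => (T₁ ω, ys ω, prefixBlock i ω)) (C := fun ω => (ω i).2)
      (A' := fun ω => (ω i).1) (B' := fun ω => (c.recon₁ (xs ω) (ys ω) i, V i ω))
      (fun ω ω' h _ => h) (fun ω ω' h _ => by
        simp only [Prod.mk.injEq] at h
        refine Prod.ext ?_ (Prod.ext ?_ h.2.2)
        · change c.g₁ (ys ω, T₁ ω) i = c.g₁ (ys ω', T₁ ω') i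
          rw [h.1, h.2.1]
        · simp only [hV, hT₂, h.1, h.2.1])
    have e1 : ent (iid n P) (fun ω => ((T₁ ω, ys ω, prefixBlock i ω), (ω i).2)) = F i :=
      ent_congr fun ω ω' => by
        simp only [Prod.mk.injEq]
        exact ⟨fun h => h.1, fun h => ⟨h, hyi h.2.1 i⟩⟩
    have e2 : ent (iid n P) (fun ω => ((ω i).1, (T₁ ω, ys ω, prefixBlock i ω), (ω i).2)) =
        F (i + 1) := ent_congr fun ω ω' => by
      simp only [Prod.mk.injEq, prefixBlock_succ_eq_iff, Prod.ext_iff (x := ω i)]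
      tauto
    linarith
  -- The message to User 2 from User 1.
  set G : ℕ → ℝ := fun k => ent (iid n P) (fun ω => (T₂ ω, prefixBlock k ω)) with hG
  have hG0 : G 0 = ent (iid n P) T₂ := ent_congr fun ω ω' => by
    simp [prefixBlock_zero_eq ω ω']
  have hGn : G n = n * ent P (fun z => z) := by
    rw [← hH]
    refine ent_congr fun ω ω' => ?_
    simp only [Prod.mk.injEq, prefixBlock_full_eq_iff]
    exact ⟨fun h => h.2, fun h => by simp [h]⟩
  have hG1 : ∀ i : Fin n, ent (iid n P) (fun ω => (((ω i).1, (ω i).2), V i ω)) = G (i + 1) :=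
    fun i => ent_congr fun ω ω' => by
      simp only [hV, Prod.mk.injEq, prefixBlock_succ_eq_iff, Prod.ext_iff (x := ω i)]
      tauto
  have hT₂le : ent (iid n P) T₂ ≤ n * R.2.1 := by
    refine (ent_le_logb_card hp T₂).trans ?_
    rwa [Fintype.card_fin]
  -- The message to User 2 from the encoder, given the message from User 1.
  set K : ℕ → ℝ := fun k => ent (iid n P) (fun ω => (T₂ ω, T₃ ω, prefixBlock k ω)) with hK
  have hK0 : K 0 ≤ ent (iid n P) T₂ + n * R.2.2 := by
    have e : K 0 = ent (iid n P) (fun ω => (T₂ ω, T₃ ω)) := ent_congr fun ω ω' => by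
      simp [prefixBlock_zero_eq ω ω']
    have e1 := ent_prod_le hp T₂ T₃
    have e2 := ent_le_logb_card hp T₃
    rw [Fintype.card_fin] at e2
    rw [e]; linarith
  have hKn : K n = n * ent P (fun z => z) := by
    rw [← hH]
    refine ent_congr fun ω ω' => ?_
    simp only [Prod.mk.injEq, prefixBlock_full_eq_iff]
    exact ⟨fun h => h.2.2, fun h => by simp [h]⟩
  have hK1 : ∀ i : Fin n, cmi (iid n P) (fun ω => (ω i).1) (fun ω => c.recon₂ (xs ω) (ys ω) i)
      (V i) ≤ (G (i + 1) - G i) - (K (i + 1) - K i) := by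
    intro i
    have := ent_data_processing hp (A := fun ω => ω i) (B := fun ω => (T₂ ω, T₃ ω)) (C := V i)
      (A' := fun ω => (ω i).1) (B' := fun ω => c.recon₂ (xs ω) (ys ω) i)
      (fun ω ω' h _ => congrArg Prod.fst h) (fun ω ω' h _ => by
        simp only [Prod.mk.injEq] at h
        simp only [hrec₂, h.1, h.2])
    have e1 : ent (iid n P) (fun ω => (ω i, V i ω)) = G (i + 1) := hG1 i
    have e2 : ent (iid n P) (fun ω => ((T₂ ω, T₃ ω), V i ω)) = K i :=
      ent_congr fun ω ω' => by simp only [hV, Prod.mk.injEq]; tauto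
    have e3 : ent (iid n P) (fun ω => (ω i, (T₂ ω, T₃ ω), V i ω)) = K (i + 1) :=
      ent_congr fun ω ω' => by
        simp only [hV, Prod.mk.injEq, prefixBlock_succ_eq_iff]; tauto
    have e4 : ent (iid n P) (V i) = G i := rfl
    rw [cmi]
    linarith
  refine mem_regionWith_of_random_variables
    (mixture_mem_stdSimplex (r := fun _ => iid n P) hw fun _ => hp)
    (fun x => (x.2 x.1).1) (fun x => (x.2 x.1).2) (fun x => c.recon₁ (xs x.2) (ys x.2) x.1)
    (fun x => c.recon₂ (xs x.2) (ys x.2) x.1) (fun x => (x.1, V x.1 x.2)) hlaw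
    ((sum_uniform_time_distortion P d₁ c.recon₁).trans_le hD₁)
    ((sum_uniform_time_distortion P d₂ c.recon₂).trans_le hD₂) ?_ ?_ ?_
  · rw [cmi_mixture_right hw.1 (r := fun _ => iid n P) (fun _ => hp) (fun i ω => (ω i).1)
      (fun i ω => c.recon₁ (xs ω) (ys ω) i) (fun i ω => (ω i).2) V (by simp), hmix, hmixY,
      ← Finset.mul_sum]
    have h := Finset.sum_le_sum fun i (_ : i ∈ Finset.univ) => hF1 i
    rw [Finset.sum_neg_distrib, sum_fin_sub F n, hFn] at h
    rw [← le_sub_iff_add_le', one_div, inv_mul_le_iff₀ hn']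
    linarith
  · rw [mutualInfo_mixture hw.1 (r := fun _ => iid n P) (fun _ => hp)
      (fun i ω => ((ω i).1, (ω i).2)) V (by simp), hmix, ← Finset.mul_sum]
    simp only [hG1]
    have h := sum_fin_sub G n
    rw [Finset.sum_sub_distrib, hGn, hG0] at h
    rw [← le_sub_iff_add_le', one_div, inv_mul_le_iff₀ hn', Finset.sum_sub_distrib]
    have e4 : ∀ i, ent (iid n P) (V i) = G i := fun _ => rfl
    simp only [e4]
    linarith
  · rw [cmi_mixture hw.1 (r := fun _ => iid n P) (fun _ => hp) (fun i ω => (ω i).1)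
      (fun i ω => c.recon₂ (xs ω) (ys ω) i) V (by simp), ← Finset.mul_sum, one_div,
      inv_mul_le_iff₀ hn']
    have h := Finset.sum_le_sum fun i (_ : i ∈ Finset.univ) => hK1 i
    rw [Finset.sum_sub_distrib, sum_fin_sub G n, sum_fin_sub K n] at h
    linarith

lemma Achievable.mem_boundedRegion {P : 𝒳 × 𝒴 → ℝ} (hP : P ∈ stdSimplex ℝ (𝒳 × 𝒴))
    {d₁ : 𝒳 → 𝒳₁ → ℝ} {d₂ : 𝒳 → 𝒳₂ → ℝ} {D₁ D₂ : ℝ} {R : ℝ × ℝ × ℝ}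
    (hR : Achievable P d₁ d₂ D₁ D₂ R) :
    R ∈ boundedRegion (Fintype.card 𝒳 * Fintype.card 𝒴 * Fintype.card 𝒳₁ * Fintype.card 𝒳₂ + 2)
      P d₁ d₂ D₁ D₂ := by
  have hε : ∀ ε : ℝ, 0 < ε → R ∈ boundedRegion
      (Fintype.card 𝒳 * Fintype.card 𝒴 * Fintype.card 𝒳₁ * Fintype.card 𝒳₂ + 2)
      P d₁ d₂ (D₁ + ε) (D₂ + ε) := by
    intro ε h
    obtain ⟨n₀, hn₀⟩ := hR ε h
    obtain ⟨c, hc₁, hc₂⟩ := hn₀ (n₀ + 1) (Nat.le_succ _)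
    have hs := nonempty_of_mem_stdSimplex (iid_mem_stdSimplex (n := n₀ + 1) hP)
    have hlog : ∀ {M : ℕ} {a : ℝ}, M = ⌊(2 : ℝ) ^ a⌋₊ → Nonempty (Fin M) →
        Real.logb 2 M ≤ a := by
      rintro M a hM ⟨i⟩
      have hpos : (0 : ℝ) < M := by exact_mod_cast i.pos
      rw [Real.logb_le_iff_le_rpow one_lt_two hpos, hM]
      exact Nat.floor_le (by positivity)
    obtain ⟨ω⟩ := hs
    have t₁ := c.f₁ (fun j => (ω j).1, fun j => (ω j).2)
    have t₃ := c.f₃ (fun j => (ω j).1, fun j => (ω j).2)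
    have t₂ := c.f₂ (fun j => (ω j).2, t₁)
    exact regionWith_subset_boundedRegion hP d₁ d₂ _ _
      (c.mem_regionWith hP (Nat.succ_pos _) d₁ d₂ hc₁ hc₂ (hlog rfl ⟨t₁⟩) (hlog rfl ⟨t₂⟩)
        (hlog rfl ⟨t₃⟩))
  have hcl := isClosed_setOf_mem_boundedRegion
    (Fintype.card 𝒳 * Fintype.card 𝒴 * Fintype.card 𝒳₁ * Fintype.card 𝒳₂ + 2) hP d₁ d₂
  have hlim : Filter.Tendsto (fun ε : ℝ => (R, D₁ + ε, D₂ + ε)) (nhdsWithin 0 (Set.Ioi 0))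
      (nhds (R, D₁, D₂)) := by
    have : Continuous fun ε : ℝ => (R, D₁ + ε, D₂ + ε) := by fun_prop
    simpa using (this.tendsto 0).mono_left nhdsWithin_le_nhds
  exact hcl.mem_of_tendsto hlim (Filter.eventually_of_mem self_mem_nhdsWithin hε)

end Converse

/-! ### Covering by codebooks -/

section Probability

variable {Ω α β : Type*} [Fintype Ω] {p : Ω → ℝ}

open Classical in
/-- The probability of the event `B` under `p`. -/
noncomputable def prob (p : Ω → ℝ) (B : Ω → Prop) : ℝ := ∑ ω, if B ω then p ω else 0

lemma prob_nonneg (hp : ∀ ω, 0 ≤ p ω) (B : Ω → Prop) : 0 ≤ prob p B :=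
  Finset.sum_nonneg fun ω _ => by split_ifs <;> simp [hp]

lemma prob_mono (hp : ∀ ω, 0 ≤ p ω) {B B' : Ω → Prop} (h : ∀ ω, 0 < p ω → B ω → B' ω) :
    prob p B ≤ prob p B' := by
  refine Finset.sum_le_sum fun ω _ => ?_
  rcases (hp ω).eq_or_lt with h0 | h0
  · simp [← h0]
  by_cases hB : B ω
  · rw [if_pos hB, if_pos (h ω h0 hB)]
  · rw [if_neg hB]; split_ifs <;> simp [hp]

lemma prob_or_le (hp : ∀ ω, 0 ≤ p ω) (B B' : Ω → Prop) :
    prob p (fun ω => B ω ∨ B' ω) ≤ prob p B + prob p B' := by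
  simp only [prob]
  rw [← Finset.sum_add_distrib]
  refine Finset.sum_le_sum fun ω _ => ?_
  have := hp ω
  by_cases h : B ω <;> by_cases h' : B' ω <;> simp [h, h', this]

lemma prob_law [Fintype α] (p : Ω → ℝ) (A : Ω → α) (B : α → Prop) :
    prob (law p A) B = prob p (fun ω => B (A ω)) := by
  classical
  have := sum_law_mul p A (fun a => if B a then 1 else 0)
  simpa [prob] using this

/-- Markov's inequality for the conditional probability of `¬ H (A, B)` given `A`: outside an event of
probability at most `2 P(¬ H (A, B))`, the conditional probability of `H (A, B)` is at
least `1/2`. -/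
lemma prob_conditional_lt_half_le [Fintype α] [Fintype β] (hp : ∀ ω, 0 ≤ p ω) (A : Ω → α)
    (B : Ω → β) (H : α → β → Prop) :
    prob p (fun ω => ¬ law p A (A ω) / 2 ≤
      prob (fun b => law p (fun ω => (A ω, B ω)) (A ω, b)) (H (A ω))) ≤
    2 * prob p (fun ω => ¬ H (A ω) (B ω)) := by
  classical
  rw [← prob_law p A fun a => ¬ law p A a / 2 ≤
      prob (fun b => law p (fun ω => (A ω, B ω)) (a, b)) (H a),
    ← prob_law p (fun ω => (A ω, B ω)) fun t => ¬ H t.1 t.2]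
  have h0 : ∀ a b, 0 ≤ law p (fun ω => (A ω, B ω)) (a, b) := fun a b => law_nonneg hp _ _
  have e : prob (law p fun ω => (A ω, B ω)) (fun t => ¬ H t.1 t.2) =
      ∑ a, prob (fun b => law p (fun ω => (A ω, B ω)) (a, b)) (fun b => ¬ H a b) :=
    Fintype.sum_prod_type _
  rw [e, Finset.mul_sum]
  refine Finset.sum_le_sum fun a _ => ?_
  have hs : law p A a = prob (fun b => law p (fun ω => (A ω, B ω)) (a, b)) (H a) +
      prob (fun b => law p (fun ω => (A ω, B ω)) (a, b)) (fun b => ¬ H a b) := by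
    simp only [prob]
    rw [← Finset.sum_add_distrib, ← sum_law_prod p A B a]
    exact Finset.sum_congr rfl fun b _ => by by_cases h : H a b <;> simp [h]
  have h1 := prob_nonneg (h0 a) (fun b => ¬ H a b)
  split_ifs with h
  · have h2 := not_le.1 h
    linarith
  · linarith

end Probability

section Covering

variable {S A K : Type*} [Fintype S] [Fintype A] [Fintype K]

lemma exists_le_of_average_le {Q φ : A → ℝ} (hQ : Q ∈ stdSimplex ℝ A) {t : ℝ}
    (h : ∑ a, Q a * φ a ≤ t) : ∃ a, φ a ≤ t := by
  by_contra! hlt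
  have h1 : ∑ a, Q a * (φ a - t) ≤ 0 := by
    simp only [mul_sub, Finset.sum_sub_distrib, ← Finset.sum_mul, hQ.2]
    linarith
  have h2 := (Finset.sum_eq_zero_iff_of_nonneg fun a _ =>
    mul_nonneg (hQ.1 a) (sub_nonneg.2 (hlt a).le)).1
    (h1.antisymm (Finset.sum_nonneg fun a _ => mul_nonneg (hQ.1 a) (sub_nonneg.2 (hlt a).le)))
  have h3 : ∑ a, Q a = 0 := Finset.sum_eq_zero fun a ha =>
    (mul_eq_zero.1 (h2 a ha)).resolve_right (sub_pos.2 (hlt a)).ne'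
  rw [hQ.2] at h3
  exact one_ne_zero h3

/-- The covering lemma, by a greedy choice of the codewords: if every source word `s` is covered by a
`Q`-random codeword with probability at least `b`, then some codebook of `M` words leaves at most the
fraction `(1 - b) ^ M` of the source uncovered, and its total cost is not above average either. The
two quantities are controlled at once by a sum with weight `l`. -/
lemma exists_codebook {Q : A → ℝ} (hQ : Q ∈ stdSimplex ℝ A) (G : S → A → Prop) {b : ℝ}
    (hb : b ≤ 1) {cost : A → ℝ} {k l : ℝ} (hl : 0 ≤ l) (hk : ∑ a, Q a * cost a ≤ k) (M : ℕ)
    (w : S → ℝ) (hw : ∀ s, 0 ≤ w s) (hG : ∀ s, 0 < w s → b ≤ prob Q (G s)) :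
    ∃ c : Fin M → A, prob w (fun s => ∀ j, ¬ G s (c j)) + l * ∑ j, cost (c j) ≤
      (1 - b) ^ M * ∑ s, w s + l * (M * k) := by
  classical
  induction M generalizing w with
  | zero => exact ⟨Fin.elim0, by simp [prob]⟩
  | succ M ih =>
    have hb' : 0 ≤ (1 - b) ^ M := pow_nonneg (by linarith) _
    obtain ⟨a, ha⟩ := exists_le_of_average_le hQ
      (φ := fun a => (1 - b) ^ M * ∑ s, (if G s a then 0 else w s) + l * cost a)
      (t := (1 - b) ^ M * ((1 - b) * ∑ s, w s) + l * k) (by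
        have h1 : ∑ a, Q a * ∑ s, (if G s a then 0 else w s) ≤ (1 - b) * ∑ s, w s := by
          simp only [Finset.mul_sum]
          rw [Finset.sum_comm]
          refine Finset.sum_le_sum fun s _ => ?_
          have h2 : ∑ a, Q a * (if G s a then 0 else w s) = (1 - prob Q (G s)) * w s := by
            rw [← hQ.2, prob, ← Finset.sum_sub_distrib, Finset.sum_mul]
            exact Finset.sum_congr rfl fun a _ => by by_cases h : G s a <;> simp [h]
          rw [h2]
          rcases (hw s).eq_or_lt with h0 | h0
          · simp [← h0]
          · exact mul_le_mul_of_nonneg_right (by linarith [hG s h0]) h0.le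
        calc ∑ a, Q a * ((1 - b) ^ M * ∑ s, (if G s a then 0 else w s) + l * cost a)
            = (1 - b) ^ M * ∑ a, Q a * ∑ s, (if G s a then 0 else w s) +
              l * ∑ a, Q a * cost a := by
              simp only [mul_add, Finset.sum_add_distrib, Finset.mul_sum, mul_left_comm]
          _ ≤ _ := add_le_add (mul_le_mul_of_nonneg_left h1 hb')
              (mul_le_mul_of_nonneg_left hk hl))
    obtain ⟨c, hc⟩ := ih (fun s => if G s a then 0 else w s)
      (fun s => by split_ifs <;> simp [hw]) (fun s hs => hG s (by
        by_cases h : G s a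
        · simp [h] at hs
        · simpa [h] using hs))
    refine ⟨Fin.cons a c, ?_⟩
    have e : prob w (fun s => ∀ j, ¬ G s ((Fin.cons a c : Fin (M + 1) → A) j)) =
        prob (fun s => if G s a then 0 else w s) (fun s => ∀ j, ¬ G s (c j)) := by
      refine Finset.sum_congr rfl fun s _ => ?_
      simp only [Fin.forall_fin_succ, Fin.cons_zero, Fin.cons_succ]
      by_cases h : G s a <;> simp [h]
    rw [e, Fin.sum_univ_succ]
    simp only [Fin.cons_zero, Fin.cons_succ]
    push_cast
    rw [pow_succ]
    linarith

/-- The covering lemma with a codebook for each value of the function `π` of the source word, where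
`Q k` is the distribution of the codewords in the codebook `k`. -/
lemma exists_conditional_codebook {Q : K → A → ℝ} (hQ : ∀ k, Q k ∈ stdSimplex ℝ A) (π : S → K)
    (G : S → A → Prop) {b : ℝ} (hb : b ≤ 1) (M : ℕ)
    (w : S → ℝ) (hw : ∀ s, 0 ≤ w s) (hG : ∀ s, 0 < w s → b ≤ prob (Q (π s)) (G s)) :
    ∃ c : K → Fin M → A, prob w (fun s => ∀ j, ¬ G s (c (π s) j)) ≤ (1 - b) ^ M * ∑ s, w s := by
  classical
  have h : ∀ k, ∃ c : Fin M → A, prob (fun s => if π s = k then w s else 0)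
      (fun s => ∀ j, ¬ G s (c j)) ≤ (1 - b) ^ M * ∑ s, if π s = k then w s else 0 := by
    intro k
    obtain ⟨c, hc⟩ := exists_codebook (hQ k) G hb (cost := 0) (k := 0) le_rfl (by simp) M
      (fun s => if π s = k then w s else 0) (fun s => by split_ifs <;> simp [hw]) (fun s hs => by
        by_cases hk : π s = k
        · subst hk
          exact hG s (by simpa using hs)
        · simp [hk] at hs)
    exact ⟨c, by simpa using hc⟩
  choose c hc using h
  refine ⟨c, ?_⟩
  have h1 := Finset.sum_le_sum fun k (_ : k ∈ Finset.univ) => hc k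
  have e1 : ∑ k, prob (fun s => if π s = k then w s else 0) (fun s => ∀ j, ¬ G s (c k j)) =
      prob w (fun s => ∀ j, ¬ G s (c (π s) j)) := by
    simp only [prob]
    rw [Finset.sum_comm]
    refine Finset.sum_congr rfl fun s _ => ?_
    rw [Finset.sum_eq_single (π s)]
    · simp
    · intro k _ hk; simp [hk.symm]
    · simp
  have e2 : ∑ k, ∑ s, (if π s = k then w s else 0) = ∑ s, w s := by
    rw [Finset.sum_comm]; simp
  rwa [e1, ← Finset.mul_sum, e2] at h1

end Covering

/-! ### The coding scheme on a block -/

section OneShot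

variable {Ω 𝒳 𝒴 𝒳₁ 𝒳₂ 𝒰 : Type*} [Fintype Ω] [Fintype 𝒳] [Fintype 𝒴] [Fintype 𝒳₁] [Fintype 𝒳₂]
  [Fintype 𝒰]

lemma exists_decoder {N L : ℕ} (hN : 0 < N) (s : Fin N → Prop)
    [DecidablePred s] (h : (Finset.univ.filter s).card ≤ L) :
    ∃ dec : Fin L → Fin N, ∀ j, s j → ∃ l, dec l = j := by
  classical
  have hle : Fintype.card {j // s j} ≤ Fintype.card (Fin L) := by
    rwa [Fintype.card_subtype, Fintype.card_fin]
  obtain ⟨i⟩ := Function.Embedding.nonempty_of_card_le hle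
  refine ⟨fun l => if h : ∃ j, i j = l then h.choose else ⟨0, hN⟩, fun j hj => ⟨i ⟨j, hj⟩, ?_⟩⟩
  have h : ∃ j', i j' = i ⟨j, hj⟩ := ⟨_, rfl⟩
  have := i.injective h.choose_spec
  simp only [dif_pos h, this]

lemma one_div_le_prob_of_density {ι : Type*} [Fintype ι] {c a : ℝ} {q q' : ι → ℝ} {B : ι → Prop}
    (hc : 1 ≤ c) (ha : 0 < a) (h : a / 2 ≤ prob q B) (hB : ∀ i, B i → q i ≤ c * (a * q' i)) :
    1 / (2 * c) ≤ prob q' B := by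
  have h1 : prob q B ≤ c * a * prob q' B := by
    simp only [prob, Finset.mul_sum]
    refine Finset.sum_le_sum fun i _ => ?_
    by_cases hi : B i
    · rw [if_pos hi, if_pos hi, mul_assoc]; exact hB i hi
    · rw [if_neg hi, if_neg hi, mul_zero]
  rw [div_le_iff₀ (by linarith)]
  refine le_of_mul_le_mul_left ?_ ha
  linarith

/-- The coding scheme on a single block, for random variables `X, Y, U, X̂₁, X̂₂` on a finite
probability space. A codebook of `N₂` words `u` covers the pairs `(x, y)`. User 1 is told the index of
the chosen `u` within the list of those codewords that are jointly typical with `y`, a list that has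
about `N₂ / cT` members, and the index of `x̂₁` in a codebook that depends on `u` and `y`. User 1
forwards the index of `u`, and the encoder sends to User 2 the index of `x̂₂` in a codebook that
depends on `u`. -/
theorem exists_one_shot_code {p : Ω → ℝ} (hp : p ∈ stdSimplex ℝ Ω)
    (X : Ω → 𝒳) (Y : Ω → 𝒴) (U : Ω → 𝒰) (X₁ : Ω → 𝒳₁) (X₂ : Ω → 𝒳₂)
    {Q₁ : 𝒴 × 𝒰 → 𝒳₁ → ℝ} (hQ₁ : ∀ k, Q₁ k ∈ stdSimplex ℝ 𝒳₁)
    {Q₂ : 𝒰 → 𝒳₂ → ℝ} (hQ₂ : ∀ k, Q₂ k ∈ stdSimplex ℝ 𝒳₂)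
    {c₀ c₁ c₂ cT : ℝ} (hc₀ : 1 ≤ c₀) (hc₁ : 1 ≤ c₁) (hc₂ : 1 ≤ c₂) (hcT : 0 < cT)
    (G₁ : 𝒳 → 𝒳₁ → Prop) (G₂ : 𝒳 → 𝒳₂ → Prop) {e : ℝ}
    (he : prob p (fun ω => ¬ (
      (law p (fun ω => ((X ω, Y ω), U ω)) ((X ω, Y ω), U ω) ≤
        c₀ * (law p (fun ω => (X ω, Y ω)) (X ω, Y ω) * law p U (U ω)) ∧
      cT * (law p Y (Y ω) * law p U (U ω)) ≤ law p (fun ω => (Y ω, U ω)) (Y ω, U ω)) ∧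
      (G₁ (X ω) (X₁ ω) ∧ law p (fun ω => (((X ω, Y ω), U ω), X₁ ω)) (((X ω, Y ω), U ω), X₁ ω) ≤
        c₁ * (law p (fun ω => ((X ω, Y ω), U ω)) ((X ω, Y ω), U ω) * Q₁ (Y ω, U ω) (X₁ ω))) ∧
      (G₂ (X ω) (X₂ ω) ∧ law p (fun ω => ((X ω, U ω), X₂ ω)) ((X ω, U ω), X₂ ω) ≤
        c₂ * (law p (fun ω => (X ω, U ω)) (X ω, U ω) * Q₂ (U ω) (X₂ ω))))) ≤ e)
    {L N₁ N₂ N₃ : ℕ} (hL : 0 < L) (hN₁ : 0 < N₁) (hN₂ : 0 < N₂) (hN₃ : 0 < N₃) :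
    ∃ (f₁ : 𝒳 × 𝒴 → Fin L × Fin N₁) (f₂ : 𝒴 × (Fin L × Fin N₁) → Fin N₂) (f₃ : 𝒳 × 𝒴 → Fin N₃)
      (g₁ : 𝒴 × (Fin L × Fin N₁) → 𝒳₁) (g₂ : Fin N₂ × Fin N₃ → 𝒳₂),
      prob (law p fun ω => (X ω, Y ω)) (fun s => ¬ (G₁ s.1 (g₁ (s.2, f₁ s)) ∧
        G₂ s.1 (g₂ (f₂ (s.2, f₁ s), f₃ s)))) ≤
      10 * e + ((1 - 1 / (2 * c₀)) ^ N₂ + N₂ / (cT * L)) + (1 - 1 / (2 * c₁)) ^ N₁ +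
        (1 - 1 / (2 * c₂)) ^ N₃ := by
  classical
  set π : 𝒳 × 𝒴 → ℝ := law p fun ω => (X ω, Y ω) with hπ
  set pU : 𝒰 → ℝ := law p U with hpU
  set pY : 𝒴 → ℝ := law p Y with hpY
  set pS : (𝒳 × 𝒴) × 𝒰 → ℝ := law p fun ω => ((X ω, Y ω), U ω) with hpS
  set pXU : 𝒳 × 𝒰 → ℝ := law p fun ω => (X ω, U ω) with hpXU
  have hπs : π ∈ stdSimplex ℝ (𝒳 × 𝒴) := law_mem_stdSimplex hp _
  have hpUs : pU ∈ stdSimplex ℝ 𝒰 := law_mem_stdSimplex hp _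
  -- Joint typicality, as used for `x̂₁`, for `x̂₂` and for the list of `y`.
  let H₁ : (𝒳 × 𝒴) × 𝒰 → 𝒳₁ → Prop := fun t a => G₁ t.1.1 a ∧
    law p (fun ω => (((X ω, Y ω), U ω), X₁ ω)) (t, a) ≤ c₁ * (pS t * Q₁ (t.1.2, t.2) a)
  let H₂ : 𝒳 × 𝒰 → 𝒳₂ → Prop := fun t b => G₂ t.1 b ∧
    law p (fun ω => ((X ω, U ω), X₂ ω)) (t, b) ≤ c₂ * (pXU t * Q₂ t.2 b)
  let T : 𝒴 → 𝒰 → Prop := fun y u => cT * (pY y * pU u) ≤ law p (fun ω => (Y ω, U ω)) (y, u)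
  let good₁ : (𝒳 × 𝒴) × 𝒰 → Prop := fun t =>
    pS t / 2 ≤ prob (fun a => law p (fun ω => (((X ω, Y ω), U ω), X₁ ω)) (t, a)) (H₁ t)
  let good₂ : 𝒳 × 𝒰 → Prop := fun t =>
    pXU t / 2 ≤ prob (fun b => law p (fun ω => ((X ω, U ω), X₂ ω)) (t, b)) (H₂ t)
  let G₀ : 𝒳 × 𝒴 → 𝒰 → Prop := fun s u => 0 < pS (s, u) ∧ pS (s, u) ≤ c₀ * (π s * pU u) ∧
    T s.2 u ∧ good₁ (s, u) ∧ good₂ (s.1, u)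
  let S' : 𝒳 × 𝒴 → Prop := fun s => π s / 2 ≤ prob (fun u => pS (s, u)) (G₀ s)
  -- Most pairs `s = (x, y)` have a typical `u` with conditional probability at least `1/2`.
  have hS' : prob π (fun s => ¬ S' s) ≤ 10 * e := by
    have h1 : prob p (fun ω => ¬ good₁ ((X ω, Y ω), U ω)) ≤ 2 * e :=
      (prob_conditional_lt_half_le hp.1 (fun ω => ((X ω, Y ω), U ω)) X₁ H₁).trans
        (mul_le_mul_of_nonneg_left ((prob_mono hp.1 fun ω _ h h' => h h'.2.1).trans he) two_pos.le)
    have h2 : prob p (fun ω => ¬ good₂ (X ω, U ω)) ≤ 2 * e :=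
      (prob_conditional_lt_half_le hp.1 (fun ω => (X ω, U ω)) X₂ H₂).trans
        (mul_le_mul_of_nonneg_left ((prob_mono hp.1 fun ω _ h h' => h h'.2.2).trans he) two_pos.le)
    have h3 : prob p (fun ω => ¬ G₀ (X ω, Y ω) (U ω)) ≤ e + (2 * e + 2 * e) := by
      refine le_trans (prob_mono hp.1 fun ω h0 h => ?_) ((prob_or_le hp.1 _ _).trans
        (add_le_add he ((prob_or_le hp.1 _ _).trans (add_le_add h1 h2))))
      by_contra! hc
      obtain ⟨hc1, hc2, hc3⟩ := hc
      exact h ⟨law_pos hp.1 (fun ω => ((X ω, Y ω), U ω)) h0, hc1.1.1, hc1.1.2, hc2, hc3⟩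
    have h4 := prob_conditional_lt_half_le hp.1 (fun ω => (X ω, Y ω)) U G₀
    rw [hπ, prob_law]
    refine h4.trans ?_
    linarith
  -- The codebook of the words `u`.
  have hb₀ : 1 / (2 * c₀) ≤ 1 := by rw [div_le_one (by linarith)]; linarith
  have hb₁ : 1 / (2 * c₁) ≤ 1 := by rw [div_le_one (by linarith)]; linarith
  have hb₂ : 1 / (2 * c₂) ≤ 1 := by rw [div_le_one (by linarith)]; linarith
  let wt : (𝒳 × 𝒴 → Prop) → 𝒳 × 𝒴 → ℝ := fun B s => if B s then π s else 0
  have hw : ∀ B, (∀ s, 0 ≤ wt B s) ∧ ∑ s, wt B s ≤ 1 := fun B =>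
    ⟨fun s => by simp only [wt]; split_ifs <;> simp [hπs.1 s], by
      rw [← hπs.2]
      exact Finset.sum_le_sum fun s _ => by simp only [wt]; split_ifs <;> simp [hπs.1 s]⟩
  have hwpos : ∀ B s, 0 < wt B s → B s ∧ 0 < π s := fun B s hs => by
    by_cases h : B s
    · simp only [wt, h, if_true] at hs; exact ⟨h, hs⟩
    · simp [wt, h] at hs
  have hwprob : ∀ B C, prob (wt B) C = prob π (fun s => B s ∧ C s) := fun B C =>
    Finset.sum_congr rfl fun s _ => by by_cases h : B s <;> by_cases h' : C s <;> simp [wt, h, h']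
  obtain ⟨cu, hcu⟩ := exists_codebook hpUs G₀ hb₀ (cost := fun u => prob pY (fun y => T y u))
    (k := 1 / cT) (l := 1 / L) (by positivity) (by
      have h1 : ∑ u, pU u * prob pY (fun y => T y u) =
          ∑ u, ∑ y, if T y u then pU u * pY y else 0 := by
        simp only [prob, Finset.mul_sum, mul_ite, mul_zero]
      have h2 : ∑ u, ∑ y, law p (fun ω => (Y ω, U ω)) (y, u) = 1 := by
        rw [← hp.2, ← sum_law p U]
        exact Finset.sum_congr rfl fun u _ => sum_law_prod' p Y U u
      rw [h1, ← h2, Finset.sum_div]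
      refine Finset.sum_le_sum fun u _ => ?_
      rw [Finset.sum_div]
      refine Finset.sum_le_sum fun y _ => ?_
      have h0 : 0 ≤ law p (fun ω => (Y ω, U ω)) (y, u) := law_nonneg hp.1 _ _
      split_ifs with h
      · rw [le_div_iff₀ hcT]
        calc pU u * pY y * cT = cT * (pY y * pU u) := by ring
          _ ≤ _ := h
      · positivity) N₂ (wt S') (hw S').1 (fun s hs =>
        one_div_le_prob_of_density hc₀ (hwpos _ s hs).2 (hwpos _ s hs).1 fun u hu => hu.2.1)
  -- The lists of codewords that are typical with `y` are rarely too long.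
  let LG : 𝒴 → Prop := fun y => (Finset.univ.filter fun j => T y (cu j)).card ≤ L
  have hLG : prob π (fun s => ¬ LG s.2) ≤ 1 / L * ∑ j, prob pY (fun y => T y (cu j)) := by
    have hY : prob π (fun s => ¬ LG s.2) = prob pY (fun y => ¬ LG y) := by
      rw [hπ, hpY, prob_law, prob_law]
    have hL' : (0 : ℝ) < L := by exact_mod_cast hL
    rw [hY, Finset.mul_sum]
    simp only [prob, Finset.mul_sum]
    rw [Finset.sum_comm]
    refine Finset.sum_le_sum fun y _ => ?_
    have hy : 0 ≤ pY y := law_nonneg hp.1 _ _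
    have hcard : ∑ j, 1 / (L : ℝ) * (if T y (cu j) then pY y else 0) =
        1 / (L : ℝ) * ((Finset.univ.filter fun j => T y (cu j)).card * pY y) := by
      rw [← Finset.mul_sum, ← Finset.sum_filter, Finset.sum_const, nsmul_eq_mul]
    refine le_trans ?_ (le_of_eq (Eq.trans hcard.symm (by congr!)))
    split_ifs with h
    · positivity
    · have h' : (L : ℝ) ≤ (Finset.univ.filter fun j => T y (cu j)).card := by
        exact_mod_cast (not_le.1 h).le
      rw [one_div, inv_mul_eq_div, le_div_iff₀ hL', mul_comm]
      exact mul_le_mul_of_nonneg_right h' hy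
  have hdec : ∀ y, ∃ dec : Fin L → Fin N₂, LG y → ∀ j, T y (cu j) → ∃ l, dec l = j := by
    intro y
    by_cases h : LG y
    · obtain ⟨dec, hdec⟩ := exists_decoder hN₂ (fun j => T y (cu j)) h
      exact ⟨dec, fun _ => hdec⟩
    · exact ⟨fun _ => ⟨0, hN₂⟩, fun h' => absurd h' h⟩
  choose dec hdec using hdec
  have hm : ∀ s, ∃ j, (∃ j', G₀ s (cu j')) → G₀ s (cu j) := by
    intro s
    by_cases h : ∃ j', G₀ s (cu j')
    · exact ⟨h.choose, fun _ => h.choose_spec⟩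
    · exact ⟨⟨0, hN₂⟩, fun h' => absurd h' h⟩
  choose m hm using hm
  let S'' : 𝒳 × 𝒴 → Prop := fun s => G₀ s (cu (m s))
  -- The codebooks of the words `x̂₁` and `x̂₂`.
  obtain ⟨c1, hc1⟩ := exists_conditional_codebook (K := 𝒴 × Fin N₂)
    (fun k => hQ₁ (k.1, cu k.2)) (fun s : 𝒳 × 𝒴 => (s.2, m s)) (fun s a => H₁ (s, cu (m s)) a)
    hb₁ N₁ (wt S'') (hw S'').1 (fun s hs => by
      have h : S'' s := (hwpos _ s hs).1
      exact one_div_le_prob_of_density hc₁ h.1 h.2.2.2.1 fun a ha => ha.2)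
  obtain ⟨c2, hc2⟩ := exists_conditional_codebook (K := Fin N₂)
    (fun k => hQ₂ (cu k)) m (fun s b => H₂ (s.1, cu (m s)) b)
    hb₂ N₃ (wt S'') (hw S'').1 (fun s hs => by
      have h : S'' s := (hwpos _ s hs).1
      have h0 : 0 < pXU (s.1, cu (m s)) := h.1.trans_le (law_mono hp.1 fun ω hω => by
        simp only [Prod.ext_iff] at hω ⊢; exact ⟨hω.1.1, hω.2⟩)
      exact one_div_le_prob_of_density hc₂ h0 h.2.2.2.2 fun a ha => ha.2)
  have hj1 : ∀ s, ∃ j : Fin N₁, (∃ j', H₁ (s, cu (m s)) (c1 (s.2, m s) j')) →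
      H₁ (s, cu (m s)) (c1 (s.2, m s) j) := by
    intro s
    by_cases h : ∃ j', H₁ (s, cu (m s)) (c1 (s.2, m s) j')
    · exact ⟨h.choose, fun _ => h.choose_spec⟩
    · exact ⟨⟨0, hN₁⟩, fun h' => absurd h' h⟩
  choose j1 hj1 using hj1
  have hj2 : ∀ s : 𝒳 × 𝒴, ∃ j : Fin N₃, (∃ j', H₂ (s.1, cu (m s)) (c2 (m s) j')) →
      H₂ (s.1, cu (m s)) (c2 (m s) j) := by
    intro s
    by_cases h : ∃ j', H₂ (s.1, cu (m s)) (c2 (m s) j')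
    · exact ⟨h.choose, fun _ => h.choose_spec⟩
    · exact ⟨⟨0, hN₃⟩, fun h' => absurd h' h⟩
  choose j2 hj2 using hj2
  have hl : ∀ s : 𝒳 × 𝒴, ∃ l : Fin L, (∃ l', dec s.2 l' = m s) → dec s.2 l = m s := by
    intro s
    by_cases h : ∃ l', dec s.2 l' = m s
    · exact ⟨h.choose, fun _ => h.choose_spec⟩
    · exact ⟨⟨0, hL⟩, fun h' => absurd h' h⟩
  choose l hl using hl
  refine ⟨fun s => (l s, j1 s), fun t => dec t.1 t.2.1, j2, fun t => c1 (t.1, dec t.1 t.2.1) t.2.2,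
    fun t => c2 t.1 t.2, ?_⟩
  have hfinal : prob π (fun s => ¬ (G₁ s.1 (c1 (s.2, dec s.2 (l s)) (j1 s)) ∧
      G₂ s.1 (c2 (dec s.2 (l s)) (j2 s)))) ≤
      prob π (fun s => ¬ S' s) + (prob (wt S')
        (fun s => ∀ j, ¬ G₀ s (cu j)) + (prob π (fun s => ¬ LG s.2) +
        (prob (wt S'')
          (fun s => ∀ j, ¬ H₁ (s, cu (m s)) (c1 (s.2, m s) j)) +
        prob (wt S'')
          (fun s => ∀ j, ¬ H₂ (s.1, cu (m s)) (c2 (m s) j))))) := by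
    simp only [hwprob]
    refine le_trans (prob_mono hπs.1 fun s _ h => ?_) ((prob_or_le hπs.1 _ _).trans
      (add_le_add le_rfl ((prob_or_le hπs.1 _ _).trans (add_le_add le_rfl
        ((prob_or_le hπs.1 _ _).trans (add_le_add le_rfl (prob_or_le hπs.1 _ _)))))))
    by_contra! hc
    obtain ⟨h1, h2, h3, h4, h5⟩ := hc
    have hg : S'' s := hm s (h2 h1)
    have hls : dec s.2 (l s) = m s := hl s (hdec s.2 h3 (m s) hg.2.2.1)
    rw [hls] at h
    exact h ⟨(hj1 s (h4 hg)).1, (hj2 s (h5 hg)).1⟩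
  have hp1 : (1 - 1 / (2 * c₁)) ^ N₁ * ∑ s, wt S'' s ≤ (1 - 1 / (2 * c₁)) ^ N₁ :=
    mul_le_of_le_one_right (pow_nonneg (by linarith) _) (hw S'').2
  have hp2 : (1 - 1 / (2 * c₂)) ^ N₃ * ∑ s, wt S'' s ≤ (1 - 1 / (2 * c₂)) ^ N₃ :=
    mul_le_of_le_one_right (pow_nonneg (by linarith) _) (hw S'').2
  have hp0 : (1 - 1 / (2 * c₀)) ^ N₂ * ∑ s, wt S' s ≤ (1 - 1 / (2 * c₀)) ^ N₂ :=
    mul_le_of_le_one_right (pow_nonneg (by linarith) _) (hw S').2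
  have hNL : 1 / (L : ℝ) * (N₂ * (1 / cT)) = N₂ / (cT * L) := by
    have : (L : ℝ) ≠ 0 := by exact_mod_cast hL.ne'
    field_simp
  rw [hNL] at hcu
  linarith

end OneShot

/-! ### Typicality, exponents and codes -/

open Filter Topology

section Typicality

variable {Ω α α' : Type*} [Fintype Ω] {q : Ω → ℝ} {n : ℕ}

/-- The weak law of large numbers, one-sided, by Chernoff's bound. -/
lemma tendsto_prob_sum_gt (hq : q ∈ stdSimplex ℝ Ω) (φ : Ω → ℝ) {a δ : ℝ}
    (ha : ∑ ω, q ω * φ ω ≤ a) (hδ : 0 < δ) :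
    Tendsto (fun n : ℕ => prob (iid n q) (fun ω => ¬ ∑ j, φ (ω j) ≤ n * (a + δ))) atTop (𝓝 0) := by
  set ψ : Ω → ℝ := fun ω => φ ω - (a + δ) with hψ
  set B : ℝ := 1 + ∑ ω, |ψ ω| with hB
  have hsum0 : 0 ≤ ∑ ω, |ψ ω| := Finset.sum_nonneg fun _ _ => abs_nonneg _
  have hB1 : 1 ≤ B := by linarith
  have hψB : ∀ ω, |ψ ω| ≤ B := fun ω => by
    have := Finset.single_le_sum (f := fun ω => |ψ ω|) (fun _ _ => abs_nonneg _) (Finset.mem_univ ω)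
    linarith
  have hmean : ∑ ω, q ω * ψ ω ≤ -δ := by
    simp only [hψ, mul_sub, Finset.sum_sub_distrib, ← Finset.sum_mul, hq.2]
    linarith
  have hδB : δ ≤ B := by
    have h1 : -∑ ω, q ω * ψ ω ≤ ∑ ω, q ω * B := by
      rw [← Finset.sum_neg_distrib]
      refine Finset.sum_le_sum fun ω _ => ?_
      rw [← mul_neg]
      exact mul_le_mul_of_nonneg_left ((neg_le_abs _).trans (hψB ω)) (hq.1 ω)
    rw [← Finset.sum_mul, hq.2] at h1
    linarith
  -- The exponent for which the quadratic term costs half of the linear gain.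
  set t : ℝ := δ / (2 * B ^ 2) with ht
  have ht0 : 0 < t := by positivity
  have htB : t * B ≤ 1 := by
    rw [ht, div_mul_eq_mul_div, div_le_one (by positivity)]
    nlinarith
  have htB2 : t * B ^ 2 = δ / 2 := by rw [ht]; field_simp
  set ρ : ℝ := ∑ ω, q ω * Real.exp (t * ψ ω) with hρ
  have hρ0 : 0 ≤ ρ := Finset.sum_nonneg fun ω _ => mul_nonneg (hq.1 ω) (Real.exp_pos _).le
  have hρ1 : ρ < 1 := by
    have h1 : ρ ≤ ∑ ω, (q ω + t * (q ω * ψ ω) + q ω * (t ^ 2 * B ^ 2)) := by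
      refine Finset.sum_le_sum fun ω _ => ?_
      have h2 : |t * ψ ω| ≤ t * B := by
        rw [abs_mul, abs_of_pos ht0]
        exact mul_le_mul_of_nonneg_left (hψB ω) ht0.le
      have h3 := (abs_le.1 (Real.abs_exp_sub_one_sub_id_le (h2.trans htB))).2
      have h4 : (t * ψ ω) ^ 2 ≤ t ^ 2 * B ^ 2 := by
        rw [← mul_pow, ← sq_abs (t * ψ ω)]
        exact pow_le_pow_left₀ (abs_nonneg _) h2 2
      calc q ω * Real.exp (t * ψ ω) ≤ q ω * (1 + t * ψ ω + t ^ 2 * B ^ 2) :=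
            mul_le_mul_of_nonneg_left (by linarith) (hq.1 ω)
        _ = _ := by ring
    rw [Finset.sum_add_distrib, Finset.sum_add_distrib, ← Finset.mul_sum, ← Finset.sum_mul,
      hq.2] at h1
    nlinarith
  refine squeeze_zero (fun n => prob_nonneg (iid_nonneg hq.1) _) (fun n => ?_)
    (tendsto_pow_atTop_nhds_zero_of_lt_one hρ0 hρ1)
  have hpow : ρ ^ n = ∑ ω : Fin n → Ω, iid n q ω * Real.exp (t * ∑ j, ψ (ω j)) := by
    have := sum_prod_apply (n := n) (fun _ ω => q ω * Real.exp (t * ψ ω))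
    rw [Finset.prod_const, Finset.card_univ, Fintype.card_fin] at this
    rw [hρ, ← this]
    refine Finset.sum_congr rfl fun ω _ => ?_
    rw [Finset.prod_mul_distrib, ← Real.exp_sum, Finset.mul_sum, iid]
  rw [hpow]
  refine Finset.sum_le_sum fun ω _ => ?_
  have h0 := iid_nonneg hq.1 ω
  split_ifs with h
  · refine le_mul_of_one_le_right h0 (Real.one_le_exp (mul_nonneg ht0.le ?_))
    simp only [hψ, Finset.sum_sub_distrib]
    simp only [Finset.sum_const, Finset.card_univ, Fintype.card_fin, nsmul_eq_mul]
    linarith [not_le.1 h]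
  · positivity

/-- The law of a block random variable `A'` that carries the same information as the letters of
`A`. -/
lemma law_iid_eq_prod (q : Ω → ℝ) (A : Ω → α) (A' : (Fin n → Ω) → α')
    (h : ∀ ω ω', A' ω = A' ω' ↔ ∀ j, A (ω j) = A (ω' j)) (ω : Fin n → Ω) :
    law (iid n q) A' (A' ω) = ∏ j, law q A (A (ω j)) := by
  rw [law_congr (B := fun ω j => A (ω j)) (b := fun j => A (ω j)) fun ω' => by
    rw [h, funext_iff], law_iid, iid]

lemma prod_le_of_sum_logb_le {f g : Fin n → ℝ} (hf : ∀ j, 0 < f j) (hg : ∀ j, 0 < g j) {s : ℝ}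
    (h : ∑ j, Real.logb 2 (f j / g j) ≤ s) : ∏ j, f j ≤ (2 : ℝ) ^ s * ∏ j, g j := by
  have hg' : 0 < ∏ j, g j := Finset.prod_pos fun j _ => hg j
  rw [← div_le_iff₀ hg', ← Finset.prod_div_distrib]
  calc ∏ j, f j / g j = ∏ j, (2 : ℝ) ^ Real.logb 2 (f j / g j) :=
        Finset.prod_congr rfl fun j _ =>
          (Real.rpow_logb two_pos (by norm_num) (div_pos (hf j) (hg j))).symm
    _ = (2 : ℝ) ^ ∑ j, Real.logb 2 (f j / g j) := (Real.rpow_sum_of_pos two_pos _ _).symm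
    _ ≤ _ := Real.rpow_le_rpow_of_exponent_le one_le_two h

/-- A block is rarely atypical, where `a` exceeds the expectation of the log density `f / g`. -/
lemma tendsto_prob_density (hq : q ∈ stdSimplex ℝ Ω) {f g : Ω → ℝ} (hf : ∀ ω, 0 < q ω → 0 < f ω)
    (hg : ∀ ω, 0 < q ω → 0 < g ω) {a δ : ℝ} (ha : ∑ ω, q ω * Real.logb 2 (f ω / g ω) ≤ a)
    (hδ : 0 < δ) :
    Tendsto (fun n : ℕ => prob (iid n q)
      (fun ω => ¬ ∏ j, f (ω j) ≤ (2 : ℝ) ^ (n * (a + δ)) * ∏ j, g (ω j))) atTop (𝓝 0) := by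
  refine squeeze_zero (fun n => prob_nonneg (iid_nonneg hq.1) _) (fun n => ?_)
    (tendsto_prob_sum_gt hq (fun ω => Real.logb 2 (f ω / g ω)) ha hδ)
  refine prob_mono (iid_nonneg hq.1) fun ω h0 h h' => h ?_
  have h1 := (iid_pos_iff hq.1 ω).1 h0
  exact prod_le_of_sum_logb_le (fun j => hf _ (h1 j)) (fun j => hg _ (h1 j)) h'

end Typicality

section Exponents

lemma half_rpow_le_floor {a : ℝ} (ha : 0 ≤ a) : (2 : ℝ) ^ a / 2 ≤ ⌊(2 : ℝ) ^ a⌋₊ := by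
  have h1 : (1 : ℝ) ≤ (2 : ℝ) ^ a := Real.one_le_rpow one_le_two ha
  have h2 : (1 : ℝ) ≤ ⌊(2 : ℝ) ^ a⌋₊ := by exact_mod_cast Nat.floor_pos.2 h1
  have h3 := Nat.lt_floor_add_one ((2 : ℝ) ^ a)
  linarith

lemma floor_rpow_pos {a : ℝ} (ha : 0 ≤ a) : 0 < ⌊(2 : ℝ) ^ a⌋₊ :=
  Nat.floor_pos.2 (Real.one_le_rpow one_le_two ha)

lemma covering_error_le (n : ℕ) {I δ : ℝ} (hI : 0 ≤ I) (hδ : 0 < δ) :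
    (1 - 1 / (2 * (2 : ℝ) ^ (n * (I + δ)))) ^ ⌊(2 : ℝ) ^ (n * (I + 2 * δ))⌋₊ ≤
      Real.exp (-((2 : ℝ) ^ (n * δ) / 4)) := by
  have hc : (1 : ℝ) ≤ (2 : ℝ) ^ (n * (I + δ)) := Real.one_le_rpow one_le_two (by positivity)
  have h1 : 1 / (2 * (2 : ℝ) ^ (n * (I + δ))) ≤ 1 := by rw [div_le_one (by linarith)]; linarith
  refine (pow_le_pow_left₀ (by linarith) (Real.one_sub_le_exp_neg _) _).trans ?_
  rw [← Real.exp_nat_mul]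
  refine Real.exp_le_exp.2 ?_
  rw [mul_neg]
  refine neg_le_neg ?_
  have h2 := half_rpow_le_floor (a := n * (I + 2 * δ)) (by positivity)
  have h3 : (2 : ℝ) ^ (n * (I + 2 * δ)) = (2 : ℝ) ^ (n * δ) * (2 : ℝ) ^ (n * (I + δ)) := by
    rw [← Real.rpow_add two_pos]; ring_nf
  rw [mul_one_div, le_div_iff₀ (by linarith)]
  calc (2 : ℝ) ^ (n * δ) / 4 * (2 * (2 : ℝ) ^ (n * (I + δ))) = (2 : ℝ) ^ (n * (I + 2 * δ)) / 2 := by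
        rw [h3]; ring
    _ ≤ _ := h2

/-- The list of jointly typical codewords is rarely too long. -/
lemma list_error_le (n : ℕ) {I J δ : ℝ} (hIJ : J ≤ I) (hδ : 0 < δ) :
    (⌊(2 : ℝ) ^ (n * (I + 2 * δ))⌋₊ : ℝ) / ((2 : ℝ) ^ (n * (J - δ)) *
      ⌊(2 : ℝ) ^ (n * (I - J + 4 * δ))⌋₊) ≤ 2 * (2 : ℝ) ^ (-(n * δ)) := by
  have h0 : 0 ≤ (n : ℝ) * (I - J + 4 * δ) := mul_nonneg n.cast_nonneg (by linarith)
  have h1 := half_rpow_le_floor h0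
  have h2 : (0 : ℝ) < ⌊(2 : ℝ) ^ (n * (I - J + 4 * δ))⌋₊ := by exact_mod_cast floor_rpow_pos h0
  rw [div_le_iff₀ (by positivity)]
  calc (⌊(2 : ℝ) ^ (n * (I + 2 * δ))⌋₊ : ℝ) ≤ (2 : ℝ) ^ (n * (I + 2 * δ)) :=
        Nat.floor_le (by positivity)
    _ = 2 * (2 : ℝ) ^ (-(n * δ)) * ((2 : ℝ) ^ (n * (J - δ)) *
        ((2 : ℝ) ^ (n * (I - J + 4 * δ)) / 2)) := by
        have : (2 : ℝ) ^ (n * (I + 2 * δ)) = (2 : ℝ) ^ (-(n * δ)) * ((2 : ℝ) ^ (n * (J - δ)) *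
            (2 : ℝ) ^ (n * (I - J + 4 * δ))) := by
          rw [← Real.rpow_add two_pos, ← Real.rpow_add two_pos]; ring_nf
        rw [this]; ring
    _ ≤ _ := by gcongr

lemma tendsto_two_rpow {δ : ℝ} (hδ : 0 < δ) :
    Tendsto (fun n : ℕ => (2 : ℝ) ^ (n * δ)) atTop atTop := by
  have h : (1 : ℝ) < (2 : ℝ) ^ δ := Real.one_lt_rpow one_lt_two hδ
  refine (tendsto_pow_atTop_atTop_of_one_lt h).congr fun n => ?_
  rw [← Real.rpow_natCast, ← Real.rpow_mul two_pos.le, mul_comm]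

end Exponents

section Codes

variable {𝒳 𝒴 𝒳₁ 𝒳₂ : Type*} {n M₁ M₂ M₃ : ℕ}

lemma expectedDistortion_le [Fintype 𝒳] [Fintype 𝒴] {𝒵 : Type*} {P : 𝒳 × 𝒴 → ℝ} (hP : P ∈ stdSimplex ℝ (𝒳 × 𝒴))
    (hn : 0 < n) {d : 𝒳 → 𝒵 → ℝ} {B D h : ℝ} (hB : ∀ x a, d x a ≤ B) (hD : 0 ≤ D)
    (hB0 : 0 ≤ B)
    (r : (Fin n → 𝒳) → (Fin n → 𝒴) → (Fin n → 𝒵))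
    (hbad : prob (fun s : (Fin n → 𝒳) × (Fin n → 𝒴) => ∏ j, P (s.1 j, s.2 j))
      (fun s => ¬ ∑ j, d (s.1 j) (r s.1 s.2 j) ≤ n * D) ≤ h) :
    expectedDistortion P d r ≤ D + B * h := by
  have hn' : (0 : ℝ) < n := by exact_mod_cast hn
  have hone : ∑ s : (Fin n → 𝒳) × (Fin n → 𝒴), ∏ j, P (s.1 j, s.2 j) = 1 := by
    rw [← (iid_mem_stdSimplex (n := n) hP).2]
    exact ((Equiv.arrowProdEquivProdArrow (Fin n) (fun _ => 𝒳) (fun _ => 𝒴)).sum_comp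
      (fun z => ∏ j, P (z.1 j, z.2 j))).symm
  rw [expectedDistortion, ← Fintype.sum_prod_type' (f := fun x y =>
    (∏ j, P (x j, y j)) * ((1 / (n : ℝ)) * ∑ j, d (x j) (r x y j)))]
  refine le_trans ?_ (add_le_add (le_refl D) (mul_le_mul_of_nonneg_left hbad hB0))
  have hsplit : D + B * prob (fun s : (Fin n → 𝒳) × (Fin n → 𝒴) => ∏ j, P (s.1 j, s.2 j))
      (fun s => ¬ ∑ j, d (s.1 j) (r s.1 s.2 j) ≤ n * D) =
      (∑ s : (Fin n → 𝒳) × (Fin n → 𝒴), (∏ j, P (s.1 j, s.2 j)) * D) +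
      B * prob (fun s : (Fin n → 𝒳) × (Fin n → 𝒴) => ∏ j, P (s.1 j, s.2 j))
      (fun s => ¬ ∑ j, d (s.1 j) (r s.1 s.2 j) ≤ n * D) := by
    rw [← Finset.sum_mul, hone, one_mul]
  rw [hsplit, prob, Finset.mul_sum, ← Finset.sum_add_distrib]
  refine Finset.sum_le_sum fun s _ => ?_
  have h0 : 0 ≤ ∏ j, P (s.1 j, s.2 j) := Finset.prod_nonneg fun _ _ => hP.1 _
  split_ifs with hs
  · have h1 : (1 / (n : ℝ)) * ∑ j, d (s.1 j) (r s.1 s.2 j) ≤ D := by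
      rw [one_div, inv_mul_le_iff₀ hn']
      exact hs
    simpa using mul_le_mul_of_nonneg_left h1 h0
  · have h1 : (1 / (n : ℝ)) * ∑ j, d (s.1 j) (r s.1 s.2 j) ≤ B := by
      rw [one_div, inv_mul_le_iff₀ hn']
      refine (Finset.sum_le_sum fun j _ => hB _ _).trans ?_
      simp
    nlinarith [mul_le_mul_of_nonneg_left h1 h0, mul_nonneg h0 hD]

/-- A code with arbitrary message alphabets that are small enough can be turned into one with the
message sets `Fin Mᵢ`. -/
lemma exists_code_of_card_le {K₁ K₂ K₃ : Type*} [Fintype K₁] [Fintype K₂] [Fintype K₃]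
    [Nonempty K₁] [Nonempty K₂] [Nonempty K₃]
    (h₁ : Fintype.card K₁ ≤ M₁) (h₂ : Fintype.card K₂ ≤ M₂) (h₃ : Fintype.card K₃ ≤ M₃)
    (f₁ : (Fin n → 𝒳) × (Fin n → 𝒴) → K₁) (f₂ : (Fin n → 𝒴) × K₁ → K₂)
    (f₃ : (Fin n → 𝒳) × (Fin n → 𝒴) → K₃)
    (g₁ : (Fin n → 𝒴) × K₁ → (Fin n → 𝒳₁)) (g₂ : K₂ × K₃ → (Fin n → 𝒳₂)) :
    ∃ c : Code 𝒳 𝒴 𝒳₁ 𝒳₂ n M₁ M₂ M₃, (∀ x y, c.recon₁ x y = g₁ (y, f₁ (x, y))) ∧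
      ∀ x y, c.recon₂ x y = g₂ (f₂ (y, f₁ (x, y)), f₃ (x, y)) := by
  obtain ⟨i₁⟩ := Function.Embedding.nonempty_of_card_le (β := Fin M₁) (by simpa using h₁)
  obtain ⟨i₂⟩ := Function.Embedding.nonempty_of_card_le (β := Fin M₂) (by simpa using h₂)
  obtain ⟨i₃⟩ := Function.Embedding.nonempty_of_card_le (β := Fin M₃) (by simpa using h₃)
  refine ⟨⟨fun s => i₁ (f₁ s), fun t => i₂ (f₂ (t.1, Function.invFun i₁ t.2)), fun s => i₃ (f₃ s),
    fun t => g₁ (t.1, Function.invFun i₁ t.2),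
    fun t => g₂ (Function.invFun i₂ t.1, Function.invFun i₃ t.2)⟩, fun x y => ?_, fun x y => ?_⟩
  · simp only [Code.recon₁, Function.leftInverse_invFun i₁.injective _]
  · simp only [Code.recon₂, Function.leftInverse_invFun i₁.injective _,
      Function.leftInverse_invFun i₂.injective _, Function.leftInverse_invFun i₃.injective _]

end Codes

/-! ### Achievability -/

section Achievability

variable {Ω 𝒳 𝒴 𝒳₁ 𝒳₂ 𝒰 α : Type*} [Fintype Ω] {q : Ω → ℝ} {n : ℕ}

/-- The block of the values of `A` at the letters of `ω`. -/
def block (A : Ω → α) (ω : Fin n → Ω) : Fin n → α := fun j => A (ω j)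

/-- The kernel that acts independently on the letters of a block. -/
def blockKernel {κ : Type*} (n : ℕ) (Q : κ → α → ℝ) (k : Fin n → κ) (a : Fin n → α) : ℝ :=
  ∏ j, Q (k j) (a j)

lemma blockKernel_mem_stdSimplex {κ : Type*} [Fintype α] {Q : κ → α → ℝ}
    (hQ : ∀ k, Q k ∈ stdSimplex ℝ α) (k : Fin n → κ) :
    blockKernel n Q k ∈ stdSimplex ℝ (Fin n → α) := by
  refine ⟨fun a => Finset.prod_nonneg fun j _ => (hQ _).1 _, ?_⟩
  simp only [blockKernel]
  rw [sum_prod_apply (fun j a => Q (k j) a)]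
  exact Finset.prod_eq_one fun j _ => (hQ _).2

/-- With high probability a block is typical in the sense that `exists_one_shot_code` requires: the log
densities that govern the three codebooks and the lists of codewords, and the two distortions, do not
exceed `n` times their expectations by more than `n δ` and `n ε`. -/
lemma tendsto_prob_atypical (hq : q ∈ stdSimplex ℝ Ω) (X : Ω → 𝒳) (Y : Ω → 𝒴) (U : Ω → 𝒰)
    (X₁ : Ω → 𝒳₁) (X₂ : Ω → 𝒳₂) {Q₁ : 𝒴 × 𝒰 → 𝒳₁ → ℝ} {Q₂ : 𝒰 → 𝒳₂ → ℝ}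
    (hQ₁ : ∀ k a, law q (fun ω => ((Y ω, U ω), X₁ ω)) (k, a) =
      law q (fun ω => (Y ω, U ω)) k * Q₁ k a)
    (hQ₂ : ∀ k b, law q (fun ω => (U ω, X₂ ω)) (k, b) = law q U k * Q₂ k b)
    (d₁ : 𝒳 → 𝒳₁ → ℝ) (d₂ : 𝒳 → 𝒳₂ → ℝ) {D₁ D₂ δ ε : ℝ}
    (hD₁ : ∑ ω, q ω * d₁ (X ω) (X₁ ω) ≤ D₁) (hD₂ : ∑ ω, q ω * d₂ (X ω) (X₂ ω) ≤ D₂)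
    (hδ : 0 < δ) (hε : 0 < ε) {I₀ J I₁ I₂ : ℝ}
    (hI₀ : ent q (fun ω => (X ω, Y ω)) + ent q U - ent q (fun ω => ((X ω, Y ω), U ω)) = I₀)
    (hJ : ent q Y + ent q U - ent q (fun ω => (Y ω, U ω)) = J)
    (hI₁ : ent q (fun ω => ((X ω, Y ω), U ω)) + ent q (fun ω => ((Y ω, U ω), X₁ ω)) -
      ent q (fun ω => (((X ω, Y ω), U ω), X₁ ω)) - ent q (fun ω => (Y ω, U ω)) = I₁)
    (hI₂ : ent q (fun ω => (X ω, U ω)) + ent q (fun ω => (U ω, X₂ ω)) -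
      ent q (fun ω => ((X ω, U ω), X₂ ω)) - ent q U = I₂) :
    Tendsto (fun n : ℕ => prob (iid n q) (fun ω : Fin n → Ω => ¬ (
      (law (iid n q) (fun ω => ((block X ω, block Y ω), block U ω))
          ((block X ω, block Y ω), block U ω) ≤
        (2 : ℝ) ^ (n * (I₀ + δ)) * (law (iid n q) (fun ω => (block X ω, block Y ω))
          (block X ω, block Y ω) * law (iid n q) (block U) (block U ω)) ∧
      (2 : ℝ) ^ (n * (J - δ)) * (law (iid n q) (block Y) (block Y ω) *
          law (iid n q) (block U) (block U ω)) ≤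
        law (iid n q) (fun ω => (block Y ω, block U ω)) (block Y ω, block U ω)) ∧
      (∑ j, d₁ (block X ω j) (block X₁ ω j) ≤ n * (D₁ + ε) ∧
        law (iid n q) (fun ω => (((block X ω, block Y ω), block U ω), block X₁ ω))
          (((block X ω, block Y ω), block U ω), block X₁ ω) ≤
        (2 : ℝ) ^ (n * (I₁ + δ)) * (law (iid n q) (fun ω => ((block X ω, block Y ω), block U ω))
          ((block X ω, block Y ω), block U ω) *
          blockKernel n Q₁ (fun j => (block Y ω j, block U ω j)) (block X₁ ω))) ∧
      (∑ j, d₂ (block X ω j) (block X₂ ω j) ≤ n * (D₂ + ε) ∧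
        law (iid n q) (fun ω => ((block X ω, block U ω), block X₂ ω))
          ((block X ω, block U ω), block X₂ ω) ≤
        (2 : ℝ) ^ (n * (I₂ + δ)) * (law (iid n q) (fun ω => (block X ω, block U ω))
          (block X ω, block U ω) * blockKernel n Q₂ (block U ω) (block X₂ ω)))))) atTop (𝓝 0) := by
  have l0 : ∀ {ω}, 0 < q ω → 0 < law q (fun ω => ((X ω, Y ω), U ω)) ((X ω, Y ω), U ω) :=
    fun h => law_pos hq.1 (fun ω => ((X ω, Y ω), U ω)) h
  have l1 : ∀ {ω}, 0 < q ω → 0 < law q (fun ω => (X ω, Y ω)) (X ω, Y ω) :=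
    fun h => law_pos hq.1 (fun ω => (X ω, Y ω)) h
  have l2 : ∀ {ω}, 0 < q ω → 0 < law q U (U ω) := fun h => law_pos hq.1 U h
  have l3 : ∀ {ω}, 0 < q ω → 0 < law q Y (Y ω) := fun h => law_pos hq.1 Y h
  have l4 : ∀ {ω}, 0 < q ω → 0 < law q (fun ω => (Y ω, U ω)) (Y ω, U ω) :=
    fun h => law_pos hq.1 (fun ω => (Y ω, U ω)) h
  have l5 : ∀ {ω}, 0 < q ω → 0 < law q (fun ω => (((X ω, Y ω), U ω), X₁ ω))
      (((X ω, Y ω), U ω), X₁ ω) := fun h => law_pos hq.1 (fun ω => (((X ω, Y ω), U ω), X₁ ω)) h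
  have l6 : ∀ {ω}, 0 < q ω → 0 < law q (fun ω => (X ω, U ω)) (X ω, U ω) :=
    fun h => law_pos hq.1 (fun ω => (X ω, U ω)) h
  have l7 : ∀ {ω}, 0 < q ω → 0 < law q (fun ω => ((X ω, U ω), X₂ ω)) ((X ω, U ω), X₂ ω) :=
    fun h => law_pos hq.1 (fun ω => ((X ω, U ω), X₂ ω)) h
  have l8 : ∀ {ω}, 0 < q ω → 0 < Q₁ (Y ω, U ω) (X₁ ω) := fun {ω} h => by
    have h1 := law_pos hq.1 (fun ω => ((Y ω, U ω), X₁ ω)) h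
    rw [hQ₁] at h1
    exact (pos_iff_pos_of_mul_pos h1).1 (l4 h)
  have l9 : ∀ {ω}, 0 < q ω → 0 < Q₂ (U ω) (X₂ ω) := fun {ω} h => by
    have h1 := law_pos hq.1 (fun ω => (U ω, X₂ ω)) h
    rw [hQ₂] at h1
    exact (pos_iff_pos_of_mul_pos h1).1 (l2 h)
  have t0 := tendsto_prob_density hq (a := I₀) (fun _ h => l0 h) (fun _ h => mul_pos (l1 h) (l2 h))
    (by
      rw [← hI₀]
      simp only [ent, ← Finset.sum_neg_distrib, ← Finset.sum_add_distrib, ← Finset.sum_sub_distrib]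
      refine (Finset.sum_congr rfl fun ω _ => ?_).le
      rcases (hq.1 ω).eq_or_lt with h | h
      · simp [← h]
      · rw [Real.logb_div (l0 h).ne' (mul_pos (l1 h) (l2 h)).ne',
          Real.logb_mul (l1 h).ne' (l2 h).ne']
        ring) hδ
  have tJ := tendsto_prob_density hq (a := -J) (fun _ h => mul_pos (l3 h) (l2 h)) (fun _ h => l4 h)
    (by
      rw [← hJ]
      simp only [ent, ← Finset.sum_neg_distrib, ← Finset.sum_add_distrib, ← Finset.sum_sub_distrib]
      refine (Finset.sum_congr rfl fun ω _ => ?_).le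
      rcases (hq.1 ω).eq_or_lt with h | h
      · simp [← h]
      · rw [Real.logb_div (mul_pos (l3 h) (l2 h)).ne' (l4 h).ne',
          Real.logb_mul (l3 h).ne' (l2 h).ne']
        ring) hδ
  have t1 := tendsto_prob_density hq (a := I₁) (fun _ h => l5 h) (fun _ h => mul_pos (l0 h) (l8 h))
    (by
      rw [← hI₁]
      simp only [ent, ← Finset.sum_neg_distrib, ← Finset.sum_add_distrib, ← Finset.sum_sub_distrib]
      refine (Finset.sum_congr rfl fun ω _ => ?_).le
      rcases (hq.1 ω).eq_or_lt with h | h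
      · simp [← h]
      · rw [Real.logb_div (l5 h).ne' (mul_pos (l0 h) (l8 h)).ne',
          Real.logb_mul (l0 h).ne' (l8 h).ne', hQ₁, Real.logb_mul (l4 h).ne' (l8 h).ne']
        ring) hδ
  have t2 := tendsto_prob_density hq (a := I₂) (fun _ h => l7 h) (fun _ h => mul_pos (l6 h) (l9 h))
    (by
      rw [← hI₂]
      simp only [ent, ← Finset.sum_neg_distrib, ← Finset.sum_add_distrib, ← Finset.sum_sub_distrib]
      refine (Finset.sum_congr rfl fun ω _ => ?_).le
      rcases (hq.1 ω).eq_or_lt with h | h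
      · simp [← h]
      · rw [Real.logb_div (l7 h).ne' (mul_pos (l6 h) (l9 h)).ne',
          Real.logb_mul (l6 h).ne' (l9 h).ne', hQ₂, Real.logb_mul (l2 h).ne' (l9 h).ne']
        ring) hδ
  have tD₁ := tendsto_prob_sum_gt hq (fun ω => d₁ (X ω) (X₁ ω)) hD₁ hε
  have tD₂ := tendsto_prob_sum_gt hq (fun ω => d₂ (X ω) (X₂ ω)) hD₂ hε
  have t := t0.add (tJ.add (tD₁.add (t1.add (tD₂.add t2))))
  simp only [add_zero] at t
  refine squeeze_zero (fun n => prob_nonneg (iid_nonneg hq.1) _) (fun n => ?_) t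
  have hp := iid_nonneg (n := n) hq.1
  refine le_trans (prob_mono hp fun ω _ h => ?_) ((prob_or_le hp _ _).trans
    (add_le_add le_rfl ((prob_or_le hp _ _).trans (add_le_add le_rfl ((prob_or_le hp _ _).trans
    (add_le_add le_rfl ((prob_or_le hp _ _).trans (add_le_add le_rfl
    (prob_or_le hp _ _)))))))))
  by_contra! hc
  obtain ⟨h0, hJ', h1, h2, h3, h4⟩ := hc
  refine h ?_
  have b0 := law_iid_eq_prod q (fun ω => ((X ω, Y ω), U ω))
    (fun ω : Fin n → Ω => ((block X ω, block Y ω), block U ω))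
    (fun ω ω' => by simp only [block, Prod.mk.injEq, funext_iff, forall_and]) ω
  have b1 := law_iid_eq_prod q (fun ω => (X ω, Y ω))
    (fun ω : Fin n → Ω => (block X ω, block Y ω))
    (fun ω ω' => by simp only [block, Prod.mk.injEq, funext_iff, forall_and]) ω
  have b2 := law_iid_eq_prod q U (block (n := n) U)
    (fun ω ω' => by simp only [block, funext_iff]) ω
  have b3 := law_iid_eq_prod q Y (block (n := n) Y)
    (fun ω ω' => by simp only [block, funext_iff]) ω
  have b4 := law_iid_eq_prod q (fun ω => (Y ω, U ω))
    (fun ω : Fin n → Ω => (block Y ω, block U ω))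
    (fun ω ω' => by simp only [block, Prod.mk.injEq, funext_iff, forall_and]) ω
  have b5 := law_iid_eq_prod q (fun ω => (((X ω, Y ω), U ω), X₁ ω))
    (fun ω : Fin n → Ω => (((block X ω, block Y ω), block U ω), block X₁ ω))
    (fun ω ω' => by simp only [block, Prod.mk.injEq, funext_iff, forall_and]) ω
  have b6 := law_iid_eq_prod q (fun ω => (X ω, U ω))
    (fun ω : Fin n → Ω => (block X ω, block U ω))
    (fun ω ω' => by simp only [block, Prod.mk.injEq, funext_iff, forall_and]) ω
  have b7 := law_iid_eq_prod q (fun ω => ((X ω, U ω), X₂ ω))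
    (fun ω : Fin n → Ω => ((block X ω, block U ω), block X₂ ω))
    (fun ω ω' => by simp only [block, Prod.mk.injEq, funext_iff, forall_and]) ω
  simp only [Finset.prod_mul_distrib] at h0 hJ' h2 h4
  rw [b0, b1, b2, b3, b4, b5, b6, b7]
  refine ⟨⟨h0, ?_⟩, ⟨h1, h2⟩, h3, h4⟩
  have hpos : (0 : ℝ) < (2 : ℝ) ^ (n * (J - δ)) := by positivity
  have hinv : (2 : ℝ) ^ (n * (J - δ)) * (2 : ℝ) ^ (n * (-J + δ)) = 1 := by
    rw [← Real.rpow_add two_pos]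
    ring_nf
    simp
  calc _ ≤ (2 : ℝ) ^ (n * (J - δ)) * ((2 : ℝ) ^ (n * (-J + δ)) *
        ∏ j, law q (fun ω => (Y ω, U ω)) (Y (ω j), U (ω j))) :=
        mul_le_mul_of_nonneg_left hJ' hpos.le
    _ = _ := by rw [← mul_assoc, hinv, one_mul]

variable [Fintype 𝒳] [Fintype 𝒴] [Fintype 𝒳₁] [Fintype 𝒳₂] [Fintype 𝒰]

/-- Random variables that satisfy the constraints with some room in the rates yield codes. A codebook
takes a rate of `2 δ` above the mutual information; the lists of User 1 take a further `2 δ`, so that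
they are rarely too short, which adds up to `6 δ` for the first message. -/
lemma achievable_of_random_variables {P : 𝒳 × 𝒴 → ℝ} (hP : P ∈ stdSimplex ℝ (𝒳 × 𝒴))
    (hq : q ∈ stdSimplex ℝ Ω) (X : Ω → 𝒳) (Y : Ω → 𝒴) (X₁ : Ω → 𝒳₁) (X₂ : Ω → 𝒳₂) (U : Ω → 𝒰)
    (hlaw : law q (fun ω => (X ω, Y ω)) = P)
    {d₁ : 𝒳 → 𝒳₁ → ℝ} (hd₁ : ∀ x a, 0 ≤ d₁ x a) {d₂ : 𝒳 → 𝒳₂ → ℝ} (hd₂ : ∀ x b, 0 ≤ d₂ x b)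
    {D₁ D₂ δ : ℝ} {R : ℝ × ℝ × ℝ}
    (hD₁ : ∑ ω, q ω * d₁ (X ω) (X₁ ω) ≤ D₁) (hD₂ : ∑ ω, q ω * d₂ (X ω) (X₂ ω) ≤ D₂)
    (hδ : 0 < δ) (h₁ : cmi q X (fun ω => (X₁ ω, U ω)) Y + 6 * δ ≤ R.1)
    (h₂ : ent q (fun ω => (X ω, Y ω)) + ent q U - ent q (fun ω => ((X ω, Y ω), U ω)) + 2 * δ ≤
      R.2.1)
    (h₃ : cmi q X X₂ U + 2 * δ ≤ R.2.2) : Achievable P d₁ d₂ D₁ D₂ R := by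
  obtain ⟨ω₀⟩ := nonempty_of_mem_stdSimplex hq
  have : Nonempty 𝒳₁ := ⟨X₁ ω₀⟩
  have : Nonempty 𝒳₂ := ⟨X₂ ω₀⟩
  obtain ⟨Q₁, hQ₁, hQ₁'⟩ := exists_disintegration (law q fun ω => ((Y ω, U ω), X₁ ω))
    (law_nonneg hq.1 _)
  obtain ⟨Q₂, hQ₂, hQ₂'⟩ := exists_disintegration (law q fun ω => (U ω, X₂ ω))
    (law_nonneg hq.1 _)
  simp only [sum_law_prod q (fun ω => (Y ω, U ω)) X₁] at hQ₁'
  simp only [sum_law_prod q U X₂] at hQ₂'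
  obtain ⟨I₀, hI₀⟩ : ∃ I, ent q (fun ω => (X ω, Y ω)) + ent q U -
    ent q (fun ω => ((X ω, Y ω), U ω)) = I := ⟨_, rfl⟩
  obtain ⟨J, hJ⟩ : ∃ I, ent q Y + ent q U - ent q (fun ω => (Y ω, U ω)) = I := ⟨_, rfl⟩
  obtain ⟨I₁, hI₁⟩ : ∃ I, ent q (fun ω => ((X ω, Y ω), U ω)) + ent q (fun ω => ((Y ω, U ω), X₁ ω)) -
    ent q (fun ω => (((X ω, Y ω), U ω), X₁ ω)) - ent q (fun ω => (Y ω, U ω)) = I := ⟨_, rfl⟩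
  obtain ⟨I₂, hI₂⟩ : ∃ I, ent q (fun ω => (X ω, U ω)) + ent q (fun ω => (U ω, X₂ ω)) -
    ent q (fun ω => ((X ω, U ω), X₂ ω)) - ent q U = I := ⟨_, rfl⟩
  -- The four rates in terms of conditional mutual informations.
  have hI₀0 : 0 ≤ I₀ := by
    have := ent_prod_le hq (fun ω => (X ω, Y ω)) U
    linarith
  have hJI : J ≤ I₀ := by
    have h := ent_submodular hq X U Y
    have e1 : ent q (fun ω => (X ω, U ω, Y ω)) = ent q (fun ω => ((X ω, Y ω), U ω)) :=
      ent_congr fun ω ω' => by simp only [Prod.mk.injEq]; tauto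
    have e2 : ent q (fun ω => (U ω, Y ω)) = ent q (fun ω => (Y ω, U ω)) :=
      ent_congr fun ω ω' => by simp only [Prod.mk.injEq]; tauto
    linarith
  have hI₁0 : 0 ≤ I₁ := by
    have h := ent_submodular hq X X₁ (fun ω => (Y ω, U ω))
    have e1 : ent q (fun ω => (X ω, X₁ ω, Y ω, U ω)) = ent q (fun ω => (((X ω, Y ω), U ω), X₁ ω)) :=
      ent_congr fun ω ω' => by simp only [Prod.mk.injEq]; tauto
    have e2 : ent q (fun ω => (X ω, Y ω, U ω)) = ent q (fun ω => ((X ω, Y ω), U ω)) :=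
      ent_congr fun ω ω' => by simp only [Prod.mk.injEq]; tauto
    have e3 : ent q (fun ω => (X₁ ω, Y ω, U ω)) = ent q (fun ω => ((Y ω, U ω), X₁ ω)) :=
      ent_congr fun ω ω' => by simp only [Prod.mk.injEq]; tauto
    linarith
  have hI₂c : cmi q X X₂ U = I₂ := by
    have e1 : ent q (fun ω => (X ω, X₂ ω, U ω)) = ent q (fun ω => ((X ω, U ω), X₂ ω)) :=
      ent_congr fun ω ω' => by simp only [Prod.mk.injEq]; tauto
    have e2 : ent q (fun ω => (X₂ ω, U ω)) = ent q (fun ω => (U ω, X₂ ω)) :=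
      ent_congr fun ω ω' => by simp only [Prod.mk.injEq]; tauto
    rw [cmi]
    linarith
  have hI₂0 : 0 ≤ I₂ := by
    have h := ent_submodular hq X X₂ U
    rw [← hI₂c, cmi]
    linarith
  have hI₁c : cmi q X (fun ω => (X₁ ω, U ω)) Y = I₀ - J + I₁ := by
    have e1 : ent q (fun ω => ((X₁ ω, U ω), Y ω)) = ent q (fun ω => ((Y ω, U ω), X₁ ω)) :=
      ent_congr fun ω ω' => by simp only [Prod.mk.injEq]; tauto
    have e2 : ent q (fun ω => (X ω, (X₁ ω, U ω), Y ω)) =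
        ent q (fun ω => (((X ω, Y ω), U ω), X₁ ω)) :=
      ent_congr fun ω ω' => by simp only [Prod.mk.injEq]; tauto
    rw [cmi]
    linarith
  rw [hI₁c] at h₁
  rw [hI₀] at h₂
  rw [hI₂c] at h₃
  intro ε hε
  have htyp := tendsto_prob_atypical hq X Y U X₁ X₂ hQ₁' hQ₂' d₁ d₂ hD₁ hD₂ hδ (half_pos hε)
    hI₀ hJ hI₁ hI₂
  set e : ℕ → ℝ := fun n => _ with he
  change Tendsto e atTop (𝓝 0) at htyp
  set h : ℕ → ℝ := fun n => 10 * e n + (Real.exp (-((2 : ℝ) ^ (n * δ) / 4)) +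
    2 * (2 : ℝ) ^ (-(n * δ))) + Real.exp (-((2 : ℝ) ^ (n * δ) / 4)) +
    Real.exp (-((2 : ℝ) ^ (n * δ) / 4)) with hh
  have hlim : Tendsto h atTop (𝓝 0) := by
    have t1 : Tendsto (fun n : ℕ => Real.exp (-((2 : ℝ) ^ (n * δ) / 4))) atTop (𝓝 0) :=
      Real.tendsto_exp_neg_atTop_nhds_zero.comp
        ((tendsto_two_rpow hδ).atTop_div_const (by norm_num))
    have t2 : Tendsto (fun n : ℕ => 2 * (2 : ℝ) ^ (-(n * δ))) atTop (𝓝 (2 * 0)) := by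
      refine Tendsto.const_mul 2 ((tendsto_two_rpow hδ).inv_tendsto_atTop.congr fun n => ?_)
      rw [Real.rpow_neg two_pos.le, Pi.inv_apply]
    have := (((htyp.const_mul 10).add (t1.add t2)).add t1).add t1
    simpa using this
  set B : ℝ := ∑ x, ∑ a, d₁ x a + ∑ x, ∑ b, d₂ x b with hB
  have hB₁ : ∀ x a, d₁ x a ≤ B := fun x a => by
    have e1 := Finset.single_le_sum (f := fun a => d₁ x a) (fun a _ => hd₁ x a) (Finset.mem_univ a)
    have e2 := Finset.single_le_sum (f := fun x => ∑ a, d₁ x a)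
      (fun x _ => Finset.sum_nonneg fun a _ => hd₁ x a) (Finset.mem_univ x)
    have e3 : 0 ≤ ∑ x, ∑ b, d₂ x b :=
      Finset.sum_nonneg fun x _ => Finset.sum_nonneg fun b _ => hd₂ x b
    linarith
  have hB₂ : ∀ x b, d₂ x b ≤ B := fun x b => by
    have e1 := Finset.single_le_sum (f := fun b => d₂ x b) (fun b _ => hd₂ x b) (Finset.mem_univ b)
    have e2 := Finset.single_le_sum (f := fun x => ∑ b, d₂ x b)
      (fun x _ => Finset.sum_nonneg fun b _ => hd₂ x b) (Finset.mem_univ x)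
    have e3 : 0 ≤ ∑ x, ∑ a, d₁ x a :=
      Finset.sum_nonneg fun x _ => Finset.sum_nonneg fun a _ => hd₁ x a
    linarith
  have hB0 : 0 ≤ B := (hd₁ (X ω₀) (X₁ ω₀)).trans (hB₁ _ _)
  have hD₁0 : 0 ≤ D₁ + ε / 2 := by
    have : 0 ≤ ∑ ω, q ω * d₁ (X ω) (X₁ ω) :=
      Finset.sum_nonneg fun ω _ => mul_nonneg (hq.1 ω) (hd₁ _ _)
    linarith
  have hD₂0 : 0 ≤ D₂ + ε / 2 := by
    have : 0 ≤ ∑ ω, q ω * d₂ (X ω) (X₂ ω) :=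
      Finset.sum_nonneg fun ω _ => mul_nonneg (hq.1 ω) (hd₂ _ _)
    linarith
  have hBh : Tendsto (fun n => B * h n) atTop (𝓝 0) := by simpa using hlim.const_mul B
  obtain ⟨n₀, hn₀⟩ := eventually_atTop.1
    ((hBh.eventually (gt_mem_nhds (half_pos hε))).and (eventually_gt_atTop 0))
  refine ⟨n₀, fun n hn => ?_⟩
  obtain ⟨hBn, hnpos⟩ := hn₀ n hn
  have hone : ∀ {I : ℝ}, 0 ≤ I → (1 : ℝ) ≤ (2 : ℝ) ^ (n * (I + δ)) := fun hI =>
    Real.one_le_rpow one_le_two (by positivity)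
  have hLe : 0 ≤ (n : ℝ) * (I₀ - J + 4 * δ) := mul_nonneg n.cast_nonneg (by linarith)
  have hL := floor_rpow_pos hLe
  have hN₁ := floor_rpow_pos (a := n * (I₁ + 2 * δ)) (by positivity)
  have hN₂ := floor_rpow_pos (a := n * (I₀ + 2 * δ)) (by positivity)
  have hN₃ := floor_rpow_pos (a := n * (I₂ + 2 * δ)) (by positivity)
  obtain ⟨f₁, f₂, f₃, g₁, g₂, hg⟩ := exists_one_shot_code (iid_mem_stdSimplex (n := n) hq)
    (block X) (block Y) (block U) (block X₁) (block X₂)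
    (Q₁ := fun k => blockKernel n Q₁ fun j => (k.1 j, k.2 j))
    (fun k => blockKernel_mem_stdSimplex hQ₁ _) (fun k => blockKernel_mem_stdSimplex hQ₂ k)
    (hone hI₀0) (hone hI₁0) (hone hI₂0) (cT := (2 : ℝ) ^ (n * (J - δ))) (by positivity)
    (fun x a => ∑ j, d₁ (x j) (a j) ≤ n * (D₁ + ε / 2))
    (fun x b => ∑ j, d₂ (x j) (b j) ≤ n * (D₂ + ε / 2)) (e := e n) le_rfl hL hN₁ hN₂ hN₃
  have hgh := hg.trans (add_le_add (add_le_add (add_le_add le_rfl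
    (add_le_add (covering_error_le n hI₀0 hδ) (list_error_le n hJI hδ)))
    (covering_error_le n hI₁0 hδ)) (covering_error_le n hI₂0 hδ))
  change _ ≤ h n at hgh
  have hπ : law (iid n q) (fun ω => (block X ω, block Y ω)) =
      fun s => ∏ j, P (s.1 j, s.2 j) := by
    funext s
    rw [← hlaw, law_congr (B := fun (ω : Fin n → Ω) j => (X (ω j), Y (ω j)))
      (b := fun j => (s.1 j, s.2 j)), law_iid q (fun ω => (X ω, Y ω)), iid]
    intro ω
    simp only [block, Prod.ext_iff, funext_iff, forall_and]
  rw [hπ] at hgh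
  have hPn : ∀ s : (Fin n → 𝒳) × (Fin n → 𝒴), 0 ≤ ∏ j, P (s.1 j, s.2 j) := fun s =>
    Finset.prod_nonneg fun j _ => hP.1 _
  have : Nonempty (Fin ⌊(2 : ℝ) ^ (n * (I₀ - J + 4 * δ))⌋₊ × Fin ⌊(2 : ℝ) ^ (n * (I₁ + 2 * δ))⌋₊) :=
    ⟨⟨0, hL⟩, ⟨0, hN₁⟩⟩
  have : Nonempty (Fin ⌊(2 : ℝ) ^ (n * (I₀ + 2 * δ))⌋₊) := ⟨⟨0, hN₂⟩⟩
  have : Nonempty (Fin ⌊(2 : ℝ) ^ (n * (I₂ + 2 * δ))⌋₊) := ⟨⟨0, hN₃⟩⟩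
  obtain ⟨c, hc₁, hc₂⟩ := exists_code_of_card_le
    (M₁ := ⌊(2 : ℝ) ^ ((n : ℝ) * R.1)⌋₊) (M₂ := ⌊(2 : ℝ) ^ ((n : ℝ) * R.2.1)⌋₊)
    (M₃ := ⌊(2 : ℝ) ^ ((n : ℝ) * R.2.2)⌋₊) (by
      rw [Fintype.card_prod, Fintype.card_fin, Fintype.card_fin]
      refine Nat.le_floor ?_
      push_cast
      calc _ ≤ (2 : ℝ) ^ (n * (I₀ - J + 4 * δ)) * (2 : ℝ) ^ (n * (I₁ + 2 * δ)) :=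
            mul_le_mul (Nat.floor_le (by positivity)) (Nat.floor_le (by positivity))
              (by positivity) (by positivity)
        _ = (2 : ℝ) ^ (n * (I₀ - J + I₁ + 6 * δ)) := by
            rw [← Real.rpow_add two_pos]; ring_nf
        _ ≤ _ := Real.rpow_le_rpow_of_exponent_le one_le_two
            (mul_le_mul_of_nonneg_left h₁ n.cast_nonneg)) (by
      rw [Fintype.card_fin]
      exact Nat.floor_mono (Real.rpow_le_rpow_of_exponent_le one_le_two
        (mul_le_mul_of_nonneg_left h₂ n.cast_nonneg))) (by
      rw [Fintype.card_fin]
      exact Nat.floor_mono (Real.rpow_le_rpow_of_exponent_le one_le_two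
        (mul_le_mul_of_nonneg_left h₃ n.cast_nonneg))) f₁ f₂ f₃ g₁ g₂
  refine ⟨c, ?_, ?_⟩
  · have := expectedDistortion_le hP hnpos hB₁ hD₁0 hB0 c.recon₁
      ((prob_mono hPn fun s _ hs hs' => hs (by rw [hc₁]; exact hs'.1)).trans hgh)
    linarith
  · have := expectedDistortion_le hP hnpos hB₂ hD₂0 hB0 c.recon₂
      ((prob_mono hPn fun s _ hs hs' => hs (by rw [hc₂]; exact hs'.2)).trans hgh)
    linarith

lemma regionWith_subset_achievableRegion {P : 𝒳 × 𝒴 → ℝ} (hP : P ∈ stdSimplex ℝ (𝒳 × 𝒴))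
    {d₁ : 𝒳 → 𝒳₁ → ℝ} (hd₁ : ∀ x a, 0 ≤ d₁ x a) {d₂ : 𝒳 → 𝒳₂ → ℝ} (hd₂ : ∀ x b, 0 ≤ d₂ x b)
    (D₁ D₂ : ℝ) : regionWith 𝒰 P d₁ d₂ D₁ D₂ ⊆ achievableRegion P d₁ d₂ D₁ D₂ := by
  rintro R ⟨W, hW, hD, hR⟩
  have hq := joint_mem_stdSimplex hP hW
  rw [rateConstraints_iff hq.1] at hR
  have hlim : Tendsto (fun δ : ℝ => (R.1 + 6 * δ, R.2.1 + 2 * δ, R.2.2 + 2 * δ)) (𝓝[>] 0)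
      (𝓝 R) := by
    have : Continuous fun δ : ℝ => (R.1 + 6 * δ, R.2.1 + 2 * δ, R.2.2 + 2 * δ) := by fun_prop
    simpa using (this.tendsto 0).mono_left nhdsWithin_le_nhds
  refine mem_closure_of_tendsto hlim (eventually_of_mem self_mem_nhdsWithin fun δ hδ => ?_)
  exact achievable_of_random_variables hP hq (fun ω => ω.1) (fun ω => ω.2.1) (fun ω => ω.2.2.1)
    (fun ω => ω.2.2.2.1) (fun ω => ω.2.2.2.2) (law_joint P hW) hd₁ hd₂ hD.1 hD.2 hδ
    (by linarith [hR.1]) (by linarith [hR.2.1]) (by linarith [hR.2.2])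

end Achievability

end TriangularSC

open TriangularSC in
theorem theorem3 {𝒳 𝒴 𝒳₁ 𝒳₂ : Type*} [Fintype 𝒳] [Fintype 𝒴] [Fintype 𝒳₁] [Fintype 𝒳₂]
    (P : 𝒳 × 𝒴 → ℝ) (hP : P ∈ stdSimplex ℝ (𝒳 × 𝒴))
    (d₁ : 𝒳 → 𝒳₁ → ℝ) (hd₁ : ∀ x a, 0 ≤ d₁ x a)
    (d₂ : 𝒳 → 𝒳₂ → ℝ) (hd₂ : ∀ x b, 0 ≤ d₂ x b)
    (D₁ D₂ : ℝ) :
    TriangularSC.achievableRegion P d₁ d₂ D₁ D₂ = TriangularSC.region P d₁ d₂ D₁ D₂ ∧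
    TriangularSC.region P d₁ d₂ D₁ D₂ =
      TriangularSC.boundedRegion
        (Fintype.card 𝒳 * Fintype.card 𝒴 * Fintype.card 𝒳₁ * Fintype.card 𝒳₂ + 2)
        P d₁ d₂ D₁ D₂ := by
  have h1 : region P d₁ d₂ D₁ D₂ = boundedRegion
      (Fintype.card 𝒳 * Fintype.card 𝒴 * Fintype.card 𝒳₁ * Fintype.card 𝒳₂ + 2)
      P d₁ d₂ D₁ D₂ := by
    refine (Set.iUnion_subset fun k => regionWith_subset_boundedRegion hP d₁ d₂ D₁ D₂).antisymm ?_
    exact Set.iUnion_mono fun k => Set.iUnion_subset fun _ => le_rfl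
  refine ⟨Set.Subset.antisymm ?_ ?_, h1⟩
  · rw [h1]
    refine closure_minimal (fun R hR => hR.mem_boundedRegion hP) ?_
    have hc : Continuous fun R : ℝ × ℝ × ℝ => (R, D₁, D₂) := by fun_prop
    exact (isClosed_setOf_mem_boundedRegion
      (Fintype.card 𝒳 * Fintype.card 𝒴 * Fintype.card 𝒳₁ * Fintype.card 𝒳₂ + 2)
      hP d₁ d₂).preimage hc
  · exact Set.iUnion_subset fun k => regionWith_subset_achievableRegion hP hd₁ hd₂ D₁ D₂
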